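/- A weighted model is a finite set $\mathcal S\subset\mathbb Z^2$ of steps with nonzero complex weights $(w_s)_{s\in\mathcal S}$; its step polynomial is $S(X,Y)=\sum_{(i,j)\in\mathcal S}w_{i,j}X^iY^j$. It is unweighted if all weights are $1$, and not univariate if both $X$ and $Y$ occur in $S$. Its kernel polynomial is $\widetilde K(X,Y,t)=X^{m_x}Y^{m_y}(1-tS(X,Y))\in\mathbb C[X,Y,t]$, where $m_x=\max(0,\max_{(i,j)\in\mathcal S}(-i))$ and $m_y=\max(0,\max_{(i,j)\in\mathcal S}(-j))$. A fraction in $\mathbb C(X,Y,t)$ is regular if its denominator in lowest terms is not divisible by $\widetilde K$. We say that $XY$ has a Galois decoupling for the model if there are $F\in\mathbb C(X,t)$, $G\in\mathbb C(Y,t)$ and a regular fraction $R\in\mathbb C(X,Y,t)$ with $XY=F+G+\widetilde K R$. Let $\mathbb K$ be an algebraic closure of $\mathbb C(x,y)$, with $x,y$ algebraically independent over $\mathbb C$. Call two pairs $(u,v),(u',v')$ of nonzero elements of $\mathbb K$ adjacent if $S(u,v)=S(u',v')$ and moreover $u=u'$ or $v=v'$. The orbit of the model is the class of $(x,y)$ under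 the reflexive transitive closure of adjacency, regarded as a graph in which distinct adjacent pairs are joined by an edge; the orbit type is its isomorphism class as a graph. Let $\mathcal O_{18}$ be the graph whose vertices are the $18$ pairs (edge of $K_{3,3}$, endpoint of that edge), two distinct pairs being joined when they have the same edge or the same endpoint. Let $\widetilde{\mathcal O_{12}}$ be the graph whose vertices are the $12$ ordered pairs of distinct elements of a set of size $4$, two distinct pairs being joined when they have the same first entry or the same second entry. A Hadamard model is a weighted model with $S(X,Y)=P(X)Q(Y)+R(X)$ for Laurent polynomials $P,Q,R$ over $\mathbb C$, such that $\deg_X\widetilde K>1$ and $\deg_Y\widetilde K>1$. For $p\ge 2$ and $z_0,\dots,z_p\in\mathbb C$ with $z_p\ne0$, the $p$-fan is the model with $S(X,Y)=\frac1{XY}+\sum_{i=0}^{p}z_i\sum_{j=0}^{i}X^jY^{i-j}$. For $\lambda\in\mathbb C$, $\mathcal G_\lambda$ is the model with $S(X,Y)=\frac1{XY}+Y+\frac XY+X^2Y+\lambda X$. Proposition. (1) $XY$ has no Galois decoupling for any Hadamard model and, more generally, for any weighted model that is not univariate and whose orbit type is that of a Hadamard model. (2) $XY$ has no Galois decoupling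 for any $p$-fan, $p\ge2$. (3) $XY$ has no Galois decoupling for any unweighted, not univariate model with steps in $\{-1,0,1,2\}^2$ whose orbit type is $\mathcal O_{18}$ or $\widetilde{\mathcal O_{12}}$. (4) $XY$ has a Galois decoupling for $\mathcal G_\lambda$, for every $\lambda\in\mathbb C$. -/

import Mathlib

noncomputable section

namespace LargeSteps

open MvPolynomial

/-! ### Weighted models and their kernel polynomials -/

/-- A weighted model: finitely many steps `(i, j)`, each with a nonzero complex weight. It is the
family of coefficients of the step polynomial `S(X, Y) = ∑ w (i, j) X ^ i Y ^ j`. -/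
abbrev WeightedModel : Type := ℤ × ℤ →₀ ℂ

/-- The model with step set `𝒮` in which every step has weight `1`. -/
def unweighted (𝒮 : Finset (ℤ × ℤ)) : WeightedModel :=
  ∑ s ∈ 𝒮, Finsupp.single s 1

/-- The step polynomial is not univariate: both variables occur in it. -/
def IsNotUnivariate (w : WeightedModel) : Prop :=
  (∃ s ∈ w.support, s.1 ≠ 0) ∧ ∃ s ∈ w.support, s.2 ≠ 0

/-- `-mX w` is the smallest move in the `X` direction (`0` if no step has a negative one). -/
def mX (w : WeightedModel) : ℕ := w.support.sup fun s => (-s.1).toNat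

/-- `-mY w` is the smallest move in the `Y` direction (`0` if no step has a negative one). -/
def mY (w : WeightedModel) : ℕ := w.support.sup fun s => (-s.2).toNat

/-- The ring `ℂ[X, Y, t]`; the variables are `X 0`, `X 1`, `X 2` in this order. -/
abbrev Poly3 : Type := MvPolynomial (Fin 3) ℂ

/-- The field `ℂ(X, Y, t)`. -/
abbrev Frac3 : Type := FractionRing Poly3

/-- The variable `X` in `ℂ(X, Y, t)`. -/
def fX : Frac3 := algebraMap Poly3 Frac3 (X 0)

/-- The variable `Y` in `ℂ(X, Y, t)`. -/
def fY : Frac3 := algebraMap Poly3 Frac3 (X 1)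

/-- The variable `t` in `ℂ(X, Y, t)`. -/
def ft : Frac3 := algebraMap Poly3 Frac3 (X 2)

/-- The kernel polynomial `X ^ m_x Y ^ m_y (1 - t S(X, Y))`. The exponents `i + m_x` and `j + m_y`
are nonnegative on the support of `w`, so that `Int.toNat` does not truncate. -/
def kernelPoly (w : WeightedModel) : Poly3 :=
  X 0 ^ mX w * X 1 ^ mY w -
    X 2 * w.sum fun s c => C c * X 0 ^ (s.1 + mX w).toNat * X 1 ^ (s.2 + mY w).toNat

/-! ### Galois decoupling -/

/-- A fraction is regular for the model `w` if, in lowest terms, its denominator is not divisible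
by the kernel polynomial. -/
def IsRegular (w : WeightedModel) (H : Frac3) : Prop :=
  ∃ A B : Poly3, B ≠ 0 ∧ IsRelPrime A B ∧
    H = algebraMap Poly3 Frac3 A / algebraMap Poly3 Frac3 B ∧ ¬ kernelPoly w ∣ B

/-- The subfield `ℂ(X, t)` of `ℂ(X, Y, t)`. -/
def fieldXt : IntermediateField ℂ Frac3 := IntermediateField.adjoin ℂ {fX, ft}

/-- The subfield `ℂ(Y, t)` of `ℂ(X, Y, t)`. -/
def fieldYt : IntermediateField ℂ Frac3 := IntermediateField.adjoin ℂ {fY, ft}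

/-- The fraction `H` has a Galois decoupling for the model `w`. -/
def HasGaloisDecoupling (w : WeightedModel) (H : Frac3) : Prop :=
  ∃ F ∈ fieldXt, ∃ G ∈ fieldYt, ∃ R : Frac3, IsRegular w R ∧
    H = F + G + algebraMap Poly3 Frac3 (kernelPoly w) * R

/-! ### The orbit of the walk -/

/-- The field `ℂ(x, y)`. -/
abbrev BaseField : Type := FractionRing (MvPolynomial (Fin 2) ℂ)

/-- An algebraic closure `𝕂` of `ℂ(x, y)`. -/
abbrev KK : Type := AlgebraicClosure BaseField

lemma algebraMap_X_ne_zero (i : Fin 2) :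
    algebraMap BaseField KK (algebraMap (MvPolynomial (Fin 2) ℂ) BaseField (X i)) ≠ 0 := by
  rw [Ne, map_eq_zero_iff _ (algebraMap BaseField KK).injective,
    map_eq_zero_iff _ (IsFractionRing.injective (MvPolynomial (Fin 2) ℂ) BaseField)]
  exact X_ne_zero i

/-- The variable `x`, as a nonzero element of `𝕂`. -/
def xK : KKˣ := Units.mk0 _ (algebraMap_X_ne_zero 0)

/-- The variable `y`, as a nonzero element of `𝕂`. -/
def yK : KKˣ := Units.mk0 _ (algebraMap_X_ne_zero 1)

/-- The value `S(u, v)` of the step polynomial at a pair of nonzero elements of `𝕂`. -/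
def stepEval (w : WeightedModel) (p : KKˣ × KKˣ) : KK :=
  w.sum fun s c => algebraMap ℂ KK c * ((p.1 ^ s.1 : KKˣ) : KK) * ((p.2 ^ s.2 : KKˣ) : KK)

/-- The relation `(u, v) ∼ˣ (u', v')`. -/
def XAdjacent (w : WeightedModel) (p q : KKˣ × KKˣ) : Prop :=
  p.1 = q.1 ∧ stepEval w p = stepEval w q

/-- The relation `(u, v) ∼ʸ (u', v')`. -/
def YAdjacent (w : WeightedModel) (p q : KKˣ × KKˣ) : Prop :=
  p.2 = q.2 ∧ stepEval w p = stepEval w q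

/-- The relation `(u, v) ∼ (u', v')`. -/
def Adjacent (w : WeightedModel) (p q : KKˣ × KKˣ) : Prop :=
  XAdjacent w p q ∨ YAdjacent w p q

/-- The orbit of the walk: the class of `(x, y)` under the reflexive transitive closure of `∼`. -/
def Orbit (w : WeightedModel) : Set (KKˣ × KKˣ) :=
  {p | Relation.ReflTransGen (Adjacent w) (xK, yK) p}

/-- The graph structure of the orbit: distinct pairs are joined when they are adjacent. -/
def orbitGraph (w : WeightedModel) : SimpleGraph (Orbit w) :=
  SimpleGraph.fromRel fun p q => Adjacent w p.1 q.1

/-- Two graphs belong to the same orbit type if they are isomorphic. The orbit type of `w` is the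
one of the graph `Γ`. -/
def HasOrbitType (w : WeightedModel) {V : Type*} (Γ : SimpleGraph V) : Prop :=
  Nonempty (orbitGraph w ≃g Γ)

/-- The orbit type `𝒪₁₈`. Its vertices are the `18` pairs consisting of an edge `(a, b)` of the
complete bipartite graph `K₃,₃` and an endpoint of this edge (`false` for `a`, `true` for `b`). Two
of them are joined if they have the same edge (cliques of size `2` of one colour) or the same
endpoint (cliques of size `3` of the other colour). -/
def O18 : SimpleGraph ((Fin 3 × Fin 3) × Bool) :=
  SimpleGraph.fromRel fun p q =>
    p.1 = q.1 ∨
    (p.2 = false ∧ q.2 = false ∧ p.1.1 = q.1.1) ∨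
    (p.2 = true ∧ q.2 = true ∧ p.1.2 = q.1.2)

/-- The orbit type `𝒪̃₁₂`. Its vertices are the `12` ordered pairs of distinct elements of a set
of size `4`. Two of them are joined if they have the same first entry (cliques of size `3` of one
colour) or the same second entry (cliques of size `3` of the other colour). -/
def O12tilde : SimpleGraph {p : Fin 4 × Fin 4 // p.1 ≠ p.2} :=
  SimpleGraph.fromRel fun p q => p.1.1 = q.1.1 ∨ p.1.2 = q.1.2

/-! ### The families of models -/

/-- Hadamard models: `S(X, Y) = P(X) Q(Y) + R(X)` for three Laurent polynomials `P`, `Q`, `R`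
(given here by their coefficients), where the kernel polynomial has degree at least `2` in `X` and
in `Y`. -/
def IsHadamard (w : WeightedModel) : Prop :=
  (∃ P Q R : ℤ →₀ ℂ, ∀ i j : ℤ, w (i, j) = P i * Q j + if j = 0 then R i else 0) ∧
    1 < (kernelPoly w).degreeOf 0 ∧ 1 < (kernelPoly w).degreeOf 1

/-- The orbit type of `w` is the orbit type of a Hadamard model. -/
def HasHadamardOrbitType (w : WeightedModel) : Prop :=
  ∃ w' : WeightedModel, IsHadamard w' ∧ HasOrbitType w (orbitGraph w')

/-- The `p`-fan with weights `z 0, …, z p`: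
`S(X, Y) = 1 / (X Y) + ∑_{i ≤ p} z i ∑_{0 ≤ j ≤ i} X ^ j Y ^ (i - j)`. -/
def fan (p : ℕ) (z : ℕ → ℂ) : WeightedModel :=
  Finsupp.single (-1, -1) 1 +
    ∑ i ∈ Finset.range (p + 1), ∑ j ∈ Finset.range (i + 1),
      Finsupp.single ((j : ℤ), (i : ℤ) - (j : ℤ)) (z i)

/-- The model `𝒢_lam`: `S(X, Y) = 1 / (X Y) + Y + X / Y + X ^ 2 Y + lam X`. -/
def modelG (lam : ℂ) : WeightedModel :=
  Finsupp.single (-1, -1) 1 + Finsupp.single (0, 1) 1 + Finsupp.single (1, -1) 1 +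
    Finsupp.single (2, 1) 1 + Finsupp.single (1, 0) lam

end LargeSteps

end

/-!
Every point `(u, v)` of the orbit has algebraically independent coordinates, so the polynomials
vanishing at `(u, v, 1 / S(u, v))` are exactly the multiples of the kernel polynomial. A Galois
decoupling can therefore be evaluated at `t = 1 / S(x, y)`, which takes the same value on the whole
orbit, and yields `u v = F(u) + G(v)` there. If the orbit contains a rectangle
`{u, u'} × {v, v'}`, the alternating sum over its corners gives `(u - u') (v - v') = 0`, a
contradiction. Rectangles are the induced `4`-cycles of the orbit graph; the orbits of Hadamard
models and of fans contain one, and so does `𝒪̃₁₂`.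

The graph `𝒪₁₈` contains none. Up to exchanging `x` and `y`, its vertices are `(u_ij, a_i)` and
`(u_ij, b_j)`, where `a_i` and `b_j` are the two roots of a quadratic whose coefficients are cubics
in `u_ij`. Eliminating `u_ij` gives a symmetric polynomial of degree `3` in each variable that
vanishes on the `3 × 3` grid of the pairs `(a_i, b_j)`, hence has rank at most `2`. The finitely
many models with this property all satisfy `τ u_ij = (1 + a_i) (1 + b_j)` or
`τ u_ij a_i b_j = (1 + a_i) (1 + b_j)` for a constant `τ`, and then `u v = F(u) + G(v)` would force
`b_1 = b_2`.
-/

noncomputable section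

namespace LargeSteps

open MvPolynomial

/-! ### Generic points -/

lemma units_pow_toNat_add {M : Type*} [CommMonoid M] (u : Mˣ) {i : ℤ} {m : ℕ} (h : 0 ≤ i + m) :
    (u : M) ^ (i + m).toNat = u ^ m * ((u ^ i : Mˣ) : M) := by
  have : u ^ (i + m).toNat = u ^ m * u ^ i := by
    rw [← zpow_natCast, Int.toNat_of_nonneg h, zpow_add, zpow_natCast, mul_comm]
  exact_mod_cast congrArg Units.val this

lemma exists_mem_eq_sup_of_pos {ι : Type*} (T : Finset ι) (f : ι → ℕ) (h : 0 < T.sup f) :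
    ∃ i ∈ T, f i = T.sup f := by
  obtain ⟨i, hi, -⟩ := Finset.lt_sup_iff.1 h
  obtain ⟨j, hj, hsup⟩ := Finset.exists_mem_eq_sup T ⟨i, hi⟩ f
  exact ⟨j, hj, hsup.symm⟩

lemma algebraicIndependent_pair_iff {F K : Type*} [Field F] [Field K] [Algebra F K] (a b : K) :
    AlgebraicIndependent F ![a, b] ↔
      Transcendental F a ∧ Transcendental (IntermediateField.adjoin F {a}) b := by
  have hother : (![a, b] : Fin 2 → K) '' {1}ᶜ = {a} := by
    ext z
    simp only [Set.mem_image, Set.mem_compl_iff, Set.mem_singleton_iff, Fin.exists_fin_two]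
    simp [eq_comm]
  have : Unique {j : Fin 2 // j ≠ 1} := ⟨⟨⟨0, by decide⟩⟩, by decide⟩
  have hdefault : ((default : {j : Fin 2 // j ≠ 1}) : Fin 2) = 0 := by
    have := (default : {j : Fin 2 // j ≠ 1}).2
    omega
  rw [AlgebraicIndependent.iff_transcendental_adjoin_image 1,
    IntermediateField.transcendental_adjoin_iff, hother, algebraicIndependent_unique_type_iff]
  simp [hdefault]

lemma isAlgebraic_of_isRoot {E K : Type*} [Field E] [Field K] [Algebra E K] {P : Polynomial K}
    (hP : P ≠ 0) (hcoeff : ∀ k, IsAlgebraic E (P.coeff k)) {v : K} (hv : P.IsRoot v) :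
    IsAlgebraic E v := by
  let L := algebraicClosure E K
  have hlifts : P ∈ Polynomial.lifts (algebraMap L K) :=
    (Polynomial.lifts_iff_coeff_lifts _).2 fun k =>
      ⟨⟨P.coeff k, mem_algebraicClosure_iff.2 (hcoeff k)⟩, rfl⟩
  obtain ⟨Q, rfl⟩ := (Polynomial.mem_lifts _).1 hlifts
  have hvL : IsAlgebraic L v := by
    refine ⟨Q, fun h => hP (by rw [h, Polynomial.map_zero]), ?_⟩
    rwa [Polynomial.aeval_def, Polynomial.eval₂_eq_eval_map]
  exact hvL.restrictScalars E

/-- A pair of elements of `𝕂` is generic if it is algebraically independent over `ℂ`. Every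
point of the orbit of a model which is not univariate is generic. -/
def Generic (p : KKˣ × KKˣ) : Prop := AlgebraicIndependent ℂ ![(p.1 : KK), (p.2 : KK)]

lemma generic_iff {p : KKˣ × KKˣ} :
    Generic p ↔ Transcendental ℂ (p.1 : KK) ∧
      Transcendental (IntermediateField.adjoin ℂ {(p.1 : KK)}) (p.2 : KK) :=
  algebraicIndependent_pair_iff _ _

lemma generic_xK_yK : Generic (xK, yK) := by
  have hX : AlgebraicIndependent ℂ (X : Fin 2 → MvPolynomial (Fin 2) ℂ) :=
    MvPolynomial.algebraicIndependent_X _ _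
  have hbase := hX.map' (f := IsScalarTower.toAlgHom ℂ (MvPolynomial (Fin 2) ℂ) BaseField)
    (IsFractionRing.injective (MvPolynomial (Fin 2) ℂ) BaseField)
  have hclosure := hbase.map' (f := IsScalarTower.toAlgHom ℂ BaseField KK)
    (algebraMap BaseField KK).injective
  unfold Generic
  convert hclosure using 1
  ext i
  fin_cases i <;> rfl

lemma Generic.swap {p : KKˣ × KKˣ} (hp : Generic p) : Generic p.swap := by
  have hcomp := hp.comp (Equiv.swap (0 : Fin 2) 1) (Equiv.injective _)
  unfold Generic
  convert hcomp using 1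
  ext i
  fin_cases i <;> simp

/-- Evaluation of step polynomials at a pair, as an additive map. -/
def stepEvalHom (p : KKˣ × KKˣ) : WeightedModel →+ KK where
  toFun w := stepEval w p
  map_zero' := Finsupp.sum_zero_index
  map_add' w w' := Finsupp.sum_add_index' (by simp) fun s c d => by rw [map_add]; ring

lemma stepEval_add (w w' : WeightedModel) (p : KKˣ × KKˣ) :
    stepEval (w + w') p = stepEval w p + stepEval w' p :=
  map_add (stepEvalHom p) w w'

lemma stepEval_sub (w w' : WeightedModel) (p : KKˣ × KKˣ) :
    stepEval (w - w') p = stepEval w p - stepEval w' p :=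
  map_sub (stepEvalHom p) w w'

lemma stepEval_sum {ι : Type*} (T : Finset ι) (f : ι → WeightedModel) (p : KKˣ × KKˣ) :
    stepEval (∑ i ∈ T, f i) p = ∑ i ∈ T, stepEval (f i) p :=
  map_sum (stepEvalHom p) f T

lemma stepEval_single (s : ℤ × ℤ) (c : ℂ) (p : KKˣ × KKˣ) :
    stepEval (Finsupp.single s c) p =
      algebraMap ℂ KK c * ((p.1 ^ s.1 : KKˣ) : KK) * ((p.2 ^ s.2 : KKˣ) : KK) :=
  Finsupp.sum_single_index (by simp)

/-- The model in which the roles of `X` and `Y` are exchanged. -/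
def transpose (w : WeightedModel) : WeightedModel := Finsupp.equivMapDomain (Equiv.prodComm ℤ ℤ) w

lemma transpose_apply (w : WeightedModel) (s : ℤ × ℤ) : transpose w s = w s.swap := rfl

lemma sum_transpose {M : Type*} [AddCommMonoid M] (w : WeightedModel) (f : ℤ × ℤ → ℂ → M) :
    (transpose w).sum f = w.sum fun s c => f s.swap c :=
  Finsupp.sum_equivMapDomain _ _ _

lemma sup_support_transpose (w : WeightedModel) (f : ℤ × ℤ → ℕ) :
    (transpose w).support.sup f = w.support.sup fun s => f s.swap := by
  change (w.support.map (Equiv.prodComm ℤ ℤ).toEmbedding).sup f = _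
  rw [Finset.sup_map]
  rfl

lemma mem_support_transpose {w : WeightedModel} {s : ℤ × ℤ} :
    s ∈ (transpose w).support ↔ s.swap ∈ w.support := by
  rw [Finsupp.mem_support_iff, Finsupp.mem_support_iff, transpose_apply]

lemma stepEval_transpose_swap (w : WeightedModel) (p : KKˣ × KKˣ) :
    stepEval (transpose w) p.swap = stepEval w p := by
  unfold stepEval
  rw [sum_transpose]
  exact Finsupp.sum_congr fun s _ => mul_right_comm _ _ _

lemma exists_mem_support_transpose_snd_ne_zero {w : WeightedModel}
    (hw : ∃ s ∈ w.support, s.1 ≠ 0) : ∃ s ∈ (transpose w).support, s.2 ≠ 0 :=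
  let ⟨s, hs, hs0⟩ := hw
  ⟨s.swap, mem_support_transpose.2 (by rwa [Prod.swap_swap]), hs0⟩

lemma mX_transpose (w : WeightedModel) : mX (transpose w) = mY w := sup_support_transpose w _

lemma mY_transpose (w : WeightedModel) : mY (transpose w) = mX w := sup_support_transpose w _

/-- The largest move in the `X` direction (`0` if no step has a positive one). -/
def maxX (w : WeightedModel) : ℕ := w.support.sup fun s => s.1.toNat

/-- The largest move in the `Y` direction (`0` if no step has a positive one). -/
def maxY (w : WeightedModel) : ℕ := w.support.sup fun s => s.2.toNat

lemma maxY_transpose (w : WeightedModel) : maxY (transpose w) = maxX w :=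
  sup_support_transpose w _

lemma fst_add_mX_nonneg {w : WeightedModel} {s : ℤ × ℤ} (hs : s ∈ w.support) :
    0 ≤ s.1 + mX w := by
  have : (-s.1).toNat ≤ mX w := Finset.le_sup (f := fun s : ℤ × ℤ => (-s.1).toNat) hs
  omega

lemma snd_add_mY_nonneg {w : WeightedModel} {s : ℤ × ℤ} (hs : s ∈ w.support) :
    0 ≤ s.2 + mY w := by
  have : (-s.2).toNat ≤ mY w := Finset.le_sup (f := fun s : ℤ × ℤ => (-s.2).toNat) hs
  omega

lemma snd_le_maxY {w : WeightedModel} {s : ℤ × ℤ} (hs : s ∈ w.support) : s.2 ≤ maxY w := by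
  have : s.2.toNat ≤ maxY w := Finset.le_sup (f := fun s : ℤ × ℤ => s.2.toNat) hs
  omega

lemma exists_snd_eq_neg_mY {w : WeightedModel} (h : 0 < mY w) :
    ∃ s ∈ w.support, s.2 = -mY w := by
  obtain ⟨s, hs, heq⟩ := exists_mem_eq_sup_of_pos w.support (fun s => (-s.2).toNat) h
  refine ⟨s, hs, ?_⟩
  unfold mY at *
  omega

lemma exists_snd_eq_maxY {w : WeightedModel} (h : 0 < maxY w) :
    ∃ s ∈ w.support, s.2 = maxY w := by
  obtain ⟨s, hs, heq⟩ := exists_mem_eq_sup_of_pos w.support (fun s => s.2.toNat) h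
  refine ⟨s, hs, ?_⟩
  unfold maxY at *
  omega

lemma exists_fst_eq_neg_mX {w : WeightedModel} (h : 0 < mX w) : ∃ s ∈ w.support, s.1 = -mX w := by
  rw [← mY_transpose] at h ⊢
  obtain ⟨s, hs, heq⟩ := exists_snd_eq_neg_mY h
  exact ⟨s.swap, mem_support_transpose.1 hs, heq⟩

lemma exists_fst_eq_maxX {w : WeightedModel} (h : 0 < maxX w) : ∃ s ∈ w.support, s.1 = maxX w := by
  rw [← maxY_transpose] at h ⊢
  obtain ⟨s, hs, heq⟩ := exists_snd_eq_maxY h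
  exact ⟨s.swap, mem_support_transpose.1 hs, heq⟩

/-- The polynomial `X ^ m_x Y ^ m_y S(X, Y)` in two of the variables of a polynomial ring. -/
def numPoly {σ : Type*} (i j : σ) (w : WeightedModel) : MvPolynomial σ ℂ :=
  w.sum fun s c => C c * X i ^ (s.1 + mX w).toNat * X j ^ (s.2 + mY w).toNat

lemma aeval_numPoly {σ : Type*} {i j : σ} (w : WeightedModel) {f : σ → KK} {p : KKˣ × KKˣ}
    (hi : f i = p.1) (hj : f j = p.2) :
    aeval f (numPoly i j w) = (p.1 : KK) ^ mX w * (p.2 : KK) ^ mY w * stepEval w p := by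
  simp only [numPoly, stepEval, Finsupp.sum, map_sum, Finset.mul_sum, map_mul, map_pow, aeval_X,
    aeval_C, hi, hj]
  refine Finset.sum_congr rfl fun s hs => ?_
  rw [units_pow_toNat_add p.1 (fst_add_mX_nonneg hs),
    units_pow_toNat_add p.2 (snd_add_mY_nonneg hs)]
  ring

lemma coeff_numPoly {σ : Type*} {i j : σ} (hij : i ≠ j) (w : WeightedModel)
    {s : ℤ × ℤ} (hs : s ∈ w.support) :
    coeff (Finsupp.single i (s.1 + mX w).toNat + Finsupp.single j (s.2 + mY w).toNat)
      (numPoly i j w) = w s := by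
  classical
  have hmonomial (r : ℤ × ℤ) : C (w r) * (X i : MvPolynomial σ ℂ) ^ (r.1 + mX w).toNat *
      X j ^ (r.2 + mY w).toNat = monomial (Finsupp.single i (r.1 + mX w).toNat +
        Finsupp.single j (r.2 + mY w).toNat) (w r) := by
    rw [X_pow_eq_monomial, X_pow_eq_monomial, C_mul_monomial, monomial_mul, mul_one, mul_one]
  simp only [numPoly, Finsupp.sum, coeff_sum, hmonomial, coeff_monomial]
  rw [Finset.sum_eq_single_of_mem s hs, if_pos rfl]
  intro r hr hrs
  refine if_neg fun h => hrs ?_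
  have hi := DFunLike.congr_fun h i
  have hj := DFunLike.congr_fun h j
  simp only [Finsupp.add_apply, Finsupp.single_eq_same, Finsupp.single_eq_of_ne hij,
    Finsupp.single_eq_of_ne hij.symm, add_zero, zero_add] at hi hj
  have := fst_add_mX_nonneg hr
  have := fst_add_mX_nonneg hs
  have := snd_add_mY_nonneg hr
  have := snd_add_mY_nonneg hs
  ext <;> omega

lemma Generic.stepEval_ne_zero {p : KKˣ × KKˣ} (hp : Generic p) {w : WeightedModel} (hw : w ≠ 0) :
    stepEval w p ≠ 0 := by
  intro h
  have hnum : numPoly (0 : Fin 2) 1 w = 0 :=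
    algebraicIndependent_iff.1 hp _ (by
      rw [aeval_numPoly w (f := ![(p.1 : KK), p.2]) rfl rfl, h, mul_zero])
  obtain ⟨s, hs⟩ := Finsupp.support_nonempty_iff.2 hw
  refine Finsupp.mem_support_iff.1 hs ?_
  rw [← coeff_numPoly (σ := Fin 2) zero_ne_one w hs, hnum, coeff_zero]

/-- The coefficient of `Y ^ j` in the step polynomial, as a model whose steps all have second
coordinate `j`. -/
def row (w : WeightedModel) (j : ℤ) : WeightedModel := w.filter fun s => s.2 = j

/-- The value at `u` of the coefficient of `Y ^ j` in the step polynomial. -/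
def rowEval (w : WeightedModel) (j : ℤ) (u : KKˣ) : KK := stepEval (row w j) (u, 1)

lemma stepEval_row (w : WeightedModel) (j : ℤ) (p : KKˣ × KKˣ) :
    stepEval (row w j) p = rowEval w j p.1 * ((p.2 ^ j : KKˣ) : KK) := by
  unfold rowEval stepEval
  rw [Finsupp.sum_mul]
  refine Finsupp.sum_congr fun s hs => ?_
  have hsj : s.2 = j := (Finset.mem_filter.1 hs).2
  simp [hsj]

lemma row_ne_zero {w : WeightedModel} {s : ℤ × ℤ} (hs : s ∈ w.support) : row w s.2 ≠ 0 := by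
  refine Finsupp.support_nonempty_iff.1 ⟨s, ?_⟩
  rw [row, Finsupp.support_filter, Finset.mem_filter]
  exact ⟨hs, rfl⟩

lemma Generic.rowEval_ne_zero {p : KKˣ × KKˣ} (hp : Generic p) {w : WeightedModel} {s : ℤ × ℤ}
    (hs : s ∈ w.support) : rowEval w s.2 p.1 ≠ 0 := by
  have := hp.stepEval_ne_zero (row_ne_zero hs)
  rw [stepEval_row] at this
  exact left_ne_zero_of_mul this

lemma rowEval_eq_sum (w : WeightedModel) (j : ℤ) (u : KKˣ) :
    rowEval w j u =
      w.sum fun s c => if s.2 = j then algebraMap ℂ KK c * ((u ^ s.1 : KKˣ) : KK) else 0 := by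
  simp only [rowEval, stepEval, row, Finsupp.sum, Finsupp.support_filter, Finset.sum_filter]
  refine Finset.sum_congr rfl fun s _ => ?_
  split_ifs with h
  · simp [h]
  · rfl

lemma isAlgebraic_adjoin_self (u : KK) : IsAlgebraic (IntermediateField.adjoin ℂ {u}) u :=
  isAlgebraic_algebraMap
    (⟨u, IntermediateField.subset_adjoin ℂ {u} rfl⟩ : IntermediateField.adjoin ℂ {u})

lemma isAlgebraic_stepEval {E : IntermediateField ℂ KK} {p : KKˣ × KKˣ}
    (hu : IsAlgebraic E (p.1 : KK)) (hv : IsAlgebraic E (p.2 : KK)) (w : WeightedModel) :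
    IsAlgebraic E (stepEval w p) := by
  let L := algebraicClosure E KK
  have huL : (p.1 : KK) ∈ L := mem_algebraicClosure_iff.2 hu
  have hvL : (p.2 : KK) ∈ L := mem_algebraicClosure_iff.2 hv
  refine mem_algebraicClosure_iff.1 (L.sum_mem fun s _ => ?_)
  simp only [Units.val_zpow_eq_zpow_val]
  exact L.mul_mem (L.mul_mem (L.algebraMap_mem (algebraMap ℂ E _)) (zpow_mem huL _))
    (zpow_mem hvL _)

lemma rowEval_eq_zero {w : WeightedModel} {j : ℤ} (h : ∀ s ∈ w.support, s.2 ≠ j) (u : KKˣ) :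
    rowEval w j u = 0 := by
  rw [rowEval_eq_sum]
  exact Finset.sum_eq_zero fun s hs => if_neg (h s hs)

/-- The polynomial `V ^ m_y (S(u, V) - σ)` in `V`, whose nonzero roots are the solutions of
`S(u, V) = σ`. -/
def fibrePoly (w : WeightedModel) (u : KKˣ) (σ : KK) : Polynomial KK :=
  (w.sum fun s c => Polynomial.C (algebraMap ℂ KK c * ((u ^ s.1 : KKˣ) : KK)) *
    Polynomial.X ^ (s.2 + mY w).toNat) - Polynomial.C σ * Polynomial.X ^ mY w

lemma coeff_fibrePoly (w : WeightedModel) (u : KKˣ) (σ : KK) (k : ℕ) :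
    (fibrePoly w u σ).coeff k =
      rowEval w ((k : ℤ) - mY w) u - if k = mY w then σ else 0 := by
  simp only [fibrePoly, rowEval_eq_sum, Finsupp.sum, Polynomial.coeff_sub,
    Polynomial.finsetSum_coeff, Polynomial.coeff_C_mul_X_pow]
  congr 1
  refine Finset.sum_congr rfl fun s hs => ?_
  have := snd_add_mY_nonneg hs
  exact if_congr (by omega) rfl rfl

lemma natDegree_fibrePoly_le (w : WeightedModel) (u : KKˣ) (σ : KK) :
    (fibrePoly w u σ).natDegree ≤ mY w + maxY w := by
  rw [Polynomial.natDegree_le_iff_coeff_eq_zero]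
  intro k hk
  rw [coeff_fibrePoly, if_neg (by omega), sub_zero]
  refine rowEval_eq_zero (fun s hs => ?_) u
  have := snd_le_maxY hs
  omega

lemma eval_fibrePoly (w : WeightedModel) (u v : KKˣ) (σ : KK) :
    (fibrePoly w u σ).eval (v : KK) = (v : KK) ^ mY w * (stepEval w (u, v) - σ) := by
  simp only [fibrePoly, stepEval, Finsupp.sum, Polynomial.eval_sub, Polynomial.eval_finsetSum,
    Polynomial.eval_mul, Polynomial.eval_C, Polynomial.eval_pow, Polynomial.eval_X, mul_sub,
    Finset.mul_sum]
  congr 1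
  · refine Finset.sum_congr rfl fun s hs => ?_
    rw [units_pow_toNat_add v (snd_add_mY_nonneg hs)]
    ring
  · ring

/-- The derivative `Y ∂S/∂Y` of the step polynomial. -/
def eulerY (w : WeightedModel) : WeightedModel :=
  Finsupp.onFinset w.support (fun s => (s.2 : ℂ) * w s)
    fun _ hs => Finsupp.mem_support_iff.2 (right_ne_zero_of_mul hs)

lemma eulerY_ne_zero {w : WeightedModel} (hw : ∃ s ∈ w.support, s.2 ≠ 0) : eulerY w ≠ 0 := by
  obtain ⟨s, hs, hs0⟩ := hw
  exact fun h => mul_ne_zero (Int.cast_ne_zero.2 hs0) (Finsupp.mem_support_iff.1 hs)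
    (DFunLike.congr_fun h s)

lemma stepEval_eulerY (w : WeightedModel) (p : KKˣ × KKˣ) :
    stepEval (eulerY w) p = w.sum fun s c =>
      (s.2 : KK) * (algebraMap ℂ KK c * ((p.1 ^ s.1 : KKˣ) : KK) * ((p.2 ^ s.2 : KKˣ) : KK)) := by
  unfold stepEval
  rw [Finsupp.sum_of_support_subset (eulerY w)
    (Finsupp.support_onFinset_subset : (eulerY w).support ⊆ w.support) _ (by simp), Finsupp.sum]
  refine Finset.sum_congr rfl fun s _ => ?_
  simp only [eulerY, Finsupp.onFinset_apply, map_mul, map_intCast]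
  ring

lemma mul_eval_derivative_fibrePoly (w : WeightedModel) (u v : KKˣ) (σ : KK) :
    (v : KK) * (Polynomial.derivative (fibrePoly w u σ)).eval (v : KK) =
      v ^ mY w * stepEval (eulerY w) (u, v) + mY w * (fibrePoly w u σ).eval (v : KK) := by
  have hpow (k : ℕ) : (v : KK) * (k * (v : KK) ^ (k - 1)) = k * (v : KK) ^ k := by
    rcases k with _ | k
    · simp only [CharP.cast_eq_zero, zero_mul, mul_zero]
    · rw [Nat.add_sub_cancel, pow_succ]
      ring
  rw [eval_fibrePoly, stepEval_eulerY]
  simp only [fibrePoly, stepEval, Finsupp.sum, Polynomial.derivative_sub,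
    Polynomial.derivative_sum, Polynomial.derivative_C_mul_X_pow, Polynomial.eval_sub,
    Polynomial.eval_finsetSum, Polynomial.eval_mul, Polynomial.eval_C, Polynomial.eval_pow,
    Polynomial.eval_X, mul_sub, Finset.mul_sum]
  rw [← add_sub_assoc, ← Finset.sum_add_distrib]
  congr 1
  · refine Finset.sum_congr rfl fun s hs => ?_
    have hcast : (((s.2 + mY w).toNat : ℕ) : KK) = s.2 + mY w := by
      exact_mod_cast congrArg (Int.cast : ℤ → KK) (Int.toNat_of_nonneg (snd_add_mY_nonneg hs))
    rw [mul_assoc, mul_left_comm, hpow, hcast, units_pow_toNat_add v (snd_add_mY_nonneg hs)]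
    ring
  · rw [mul_assoc, mul_left_comm, hpow]
    ring

/-- The solutions `v` of `S(u, v) = S(p)`, where `u` is the first coordinate of `p`. -/
def fibreY (w : WeightedModel) (p : KKˣ × KKˣ) : Set KKˣ :=
  {v | stepEval w (p.1, v) = stepEval w p}

/-- The solutions `u` of `S(u, v) = S(p)`, where `v` is the second coordinate of `p`. -/
def fibreX (w : WeightedModel) (p : KKˣ × KKˣ) : Set KKˣ :=
  {u | stepEval w (u, p.2) = stepEval w p}

lemma fibreY_transpose_swap (w : WeightedModel) (p : KKˣ × KKˣ) :
    fibreY (transpose w) p.swap = fibreX w p := by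
  ext u
  change stepEval (transpose w) (u, p.2).swap = stepEval (transpose w) p.swap ↔ _
  rw [stepEval_transpose_swap, stepEval_transpose_swap]
  rfl

namespace Generic

variable {w : WeightedModel} {p : KKˣ × KKˣ}

lemma coeff_mY_fibrePoly_ne_zero (hp : Generic p) (hw : ∃ s ∈ w.support, s.2 ≠ 0) :
    (fibrePoly w p.1 (stepEval w p)).coeff (mY w) ≠ 0 := by
  obtain ⟨s, hs, hs0⟩ := hw
  have hne : row w 0 - w ≠ 0 := by
    refine sub_ne_zero.2 fun h => Finsupp.mem_support_iff.1 hs ?_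
    rw [← h, row, Finsupp.filter_apply_neg (fun r : ℤ × ℤ => r.2 = 0) w hs0]
  have := hp.stepEval_ne_zero hne
  rw [stepEval_sub, stepEval_row] at this
  rw [coeff_fibrePoly, if_pos rfl, sub_self]
  simpa only [zpow_zero, Units.val_one, mul_one] using this

lemma coeff_zero_fibrePoly_ne_zero (hp : Generic p) (hw : ∃ s ∈ w.support, s.2 ≠ 0) :
    (fibrePoly w p.1 (stepEval w p)).coeff 0 ≠ 0 := by
  rcases Nat.eq_zero_or_pos (mY w) with h | h
  · exact h ▸ hp.coeff_mY_fibrePoly_ne_zero hw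
  · obtain ⟨s, hs, hs1⟩ := exists_snd_eq_neg_mY h
    rw [coeff_fibrePoly, if_neg h.ne, sub_zero, Nat.cast_zero, zero_sub, ← hs1]
    exact hp.rowEval_ne_zero hs

lemma coeff_mY_add_maxY_fibrePoly_ne_zero (hp : Generic p) (hw : ∃ s ∈ w.support, s.2 ≠ 0) :
    (fibrePoly w p.1 (stepEval w p)).coeff (mY w + maxY w) ≠ 0 := by
  rcases Nat.eq_zero_or_pos (maxY w) with h | h
  · exact h ▸ hp.coeff_mY_fibrePoly_ne_zero hw
  · obtain ⟨s, hs, hs1⟩ := exists_snd_eq_maxY h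
    rw [coeff_fibrePoly, if_neg (by omega), sub_zero, Nat.cast_add, add_sub_cancel_left, ← hs1]
    exact hp.rowEval_ne_zero hs

lemma fibrePoly_ne_zero (hp : Generic p) (hw : ∃ s ∈ w.support, s.2 ≠ 0) :
    fibrePoly w p.1 (stepEval w p) ≠ 0 :=
  fun h => hp.coeff_zero_fibrePoly_ne_zero hw (by rw [h, Polynomial.coeff_zero])

lemma natDegree_fibrePoly (hp : Generic p) (hw : ∃ s ∈ w.support, s.2 ≠ 0) :
    (fibrePoly w p.1 (stepEval w p)).natDegree = mY w + maxY w :=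
  le_antisymm (natDegree_fibrePoly_le _ _ _)
    (Polynomial.le_natDegree_of_ne_zero (hp.coeff_mY_add_maxY_fibrePoly_ne_zero hw))

lemma transcendental_stepEval (hp : Generic p) (hw : ∃ s ∈ w.support, s.2 ≠ 0) :
    Transcendental (IntermediateField.adjoin ℂ {(p.1 : KK)}) (stepEval w p) := by
  intro halg_σ
  refine (generic_iff.1 hp).2 (isAlgebraic_of_isRoot (hp.fibrePoly_ne_zero hw) (fun k => ?_)
    ((eval_fibrePoly w p.1 p.2 _).trans (by rw [sub_self, mul_zero])))
  have halg_u := isAlgebraic_adjoin_self (p.1 : KK)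
  rw [coeff_fibrePoly]
  refine (isAlgebraic_stepEval (p := (p.1, 1)) halg_u isAlgebraic_one _).sub ?_
  split_ifs
  · exact halg_σ
  · exact isAlgebraic_zero

lemma of_stepEval_eq {q : KKˣ × KKˣ} (hp : Generic p) (hw : ∃ s ∈ w.support, s.2 ≠ 0)
    (hfst : p.1 = q.1) (heq : stepEval w p = stepEval w q) : Generic q := by
  refine generic_iff.2 ⟨hfst ▸ (generic_iff.1 hp).1, hfst ▸ fun halg_v => ?_⟩
  refine hp.transcendental_stepEval hw (heq ▸ isAlgebraic_stepEval ?_ halg_v w)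
  exact hfst ▸ isAlgebraic_adjoin_self _

lemma isRoot_fibrePoly_iff (hp : Generic p) (hw : ∃ s ∈ w.support, s.2 ≠ 0) {z : KK} :
    (fibrePoly w p.1 (stepEval w p)).IsRoot z ↔ ∃ v ∈ fibreY w p, (v : KK) = z := by
  constructor
  · intro hz
    have hz0 : z ≠ 0 := by
      rintro rfl
      exact hp.coeff_zero_fibrePoly_ne_zero hw (by rwa [Polynomial.coeff_zero_eq_eval_zero])
    refine ⟨Units.mk0 z hz0, ?_, rfl⟩
    have := (eval_fibrePoly w p.1 (Units.mk0 z hz0) _).symm.trans hz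
    exact sub_eq_zero.1 ((mul_eq_zero.1 this).resolve_left (pow_ne_zero _ hz0))
  · rintro ⟨v, hv, rfl⟩
    rw [Polynomial.IsRoot, eval_fibrePoly, sub_eq_zero.2 hv, mul_zero]

lemma eval_derivative_fibrePoly_ne_zero (hp : Generic p) (hw : ∃ s ∈ w.support, s.2 ≠ 0) {v : KKˣ}
    (hv : v ∈ fibreY w p) :
    (Polynomial.derivative (fibrePoly w p.1 (stepEval w p))).eval (v : KK) ≠ 0 := by
  have hq : Generic (p.1, v) := hp.of_stepEval_eq hw rfl hv.symm
  intro h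
  have key := mul_eval_derivative_fibrePoly w p.1 v (stepEval w p)
  rw [h, mul_zero, eval_fibrePoly, sub_eq_zero.2 hv, mul_zero, mul_zero, add_zero] at key
  exact mul_ne_zero (pow_ne_zero _ v.ne_zero) (hq.stepEval_ne_zero (eulerY_ne_zero hw)) key.symm

lemma nodup_roots_fibrePoly (hp : Generic p) (hw : ∃ s ∈ w.support, s.2 ≠ 0) :
    (fibrePoly w p.1 (stepEval w p)).roots.Nodup := by
  classical
  rw [Multiset.nodup_iff_count_le_one]
  intro z
  rw [Polynomial.count_roots]
  by_contra! hmult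
  obtain ⟨hroot, hderiv⟩ :=
    (Polynomial.one_lt_rootMultiplicity_iff_isRoot (hp.fibrePoly_ne_zero hw)).1 hmult
  obtain ⟨v, hv, rfl⟩ := (hp.isRoot_fibrePoly_iff hw).1 hroot
  exact hp.eval_derivative_fibrePoly_ne_zero hw hv hderiv

lemma ncard_fibreY (hp : Generic p) (hw : ∃ s ∈ w.support, s.2 ≠ 0) :
    (fibreY w p).ncard = mY w + maxY w := by
  classical
  have himage : Units.val '' fibreY w p = (fibrePoly w p.1 (stepEval w p)).roots.toFinset := by
    ext z
    rw [Finset.mem_coe, Multiset.mem_toFinset, Polynomial.mem_roots (hp.fibrePoly_ne_zero hw),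
      hp.isRoot_fibrePoly_iff hw, Set.mem_image]
  rw [← Set.ncard_image_of_injective _ Units.val_injective, himage, Set.ncard_coe_finset,
    Multiset.toFinset_card_of_nodup (hp.nodup_roots_fibrePoly hw), ← hp.natDegree_fibrePoly hw]
  exact (IsAlgClosed.splits _).natDegree_eq_card_roots.symm

lemma ncard_fibreX (hp : Generic p) (hw : ∃ s ∈ w.support, s.1 ≠ 0) :
    (fibreX w p).ncard = mX w + maxX w := by
  rw [← fibreY_transpose_swap,
    hp.swap.ncard_fibreY (exists_mem_support_transpose_snd_ne_zero hw), mY_transpose,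
    maxY_transpose]

end Generic

lemma Generic.finite_fibreX {w : WeightedModel} {p : KKˣ × KKˣ} (hp : Generic p)
    (hw : ∃ s ∈ w.support, s.1 ≠ 0) : (fibreX w p).Finite := by
  refine Set.finite_of_ncard_ne_zero ?_
  rw [hp.ncard_fibreX hw]
  obtain ⟨s, hs, hs0⟩ := hw
  have hmin := fst_add_mX_nonneg hs
  have hmax : s.1 ≤ maxX w := maxY_transpose w ▸
    snd_le_maxY (s := s.swap) (mem_support_transpose.2 (by rwa [Prod.swap_swap]))
  omega

lemma Generic.transcendental_int_stepEval {w : WeightedModel} {p : KKˣ × KKˣ} (hp : Generic p)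
    (hw : ∃ s ∈ w.support, s.2 ≠ 0) : Transcendental ℤ (stepEval w p) :=
  fun ⟨P, hP0, hP⟩ => hp.transcendental_stepEval hw
    ⟨P.map (Int.castRingHom _), (Polynomial.map_ne_zero_iff (RingHom.injective_int _)).2 hP0, by
      rw [Polynomial.aeval_def, Polynomial.eval₂_map, ← hP, Polynomial.aeval_def]
      exact congrArg (Polynomial.eval₂ · _ P) (RingHom.ext_int _ _)⟩

lemma IsNotUnivariate.generic_of_mem_orbit {w : WeightedModel} (hw : IsNotUnivariate w)
    {p : KKˣ × KKˣ} (hp : p ∈ Orbit w) : Generic p := by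
  induction hp with
  | refl => exact generic_xK_yK
  | @tail q r _ hqr hq =>
    rcases hqr with ⟨hfst, heq⟩ | ⟨hsnd, heq⟩
    · exact hq.of_stepEval_eq hw.2 hfst heq
    · refine (hq.swap.of_stepEval_eq (q := r.swap)
        (exists_mem_support_transpose_snd_ne_zero hw.1) hsnd ?_).swap
      rw [stepEval_transpose_swap, stepEval_transpose_swap, heq]

lemma stepEval_of_mem_orbit {w : WeightedModel} {p : KKˣ × KKˣ} (hp : p ∈ Orbit w) :
    stepEval w p = stepEval w (xK, yK) := by
  induction hp with
  | refl => rfl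
  | tail _ hqr ih => exact (hqr.elim And.right And.right).symm.trans ih

lemma mem_orbit_of_mem_fibreY {w : WeightedModel} {p : KKˣ × KKˣ} (hp : p ∈ Orbit w) {v : KKˣ}
    (hv : v ∈ fibreY w p) : (p.1, v) ∈ Orbit w :=
  hp.tail (.inl ⟨rfl, hv.symm⟩)

lemma mem_orbit_of_mem_fibreX {w : WeightedModel} {p : KKˣ × KKˣ} (hp : p ∈ Orbit w) {u : KKˣ}
    (hu : u ∈ fibreX w p) : (u, p.2) ∈ Orbit w :=
  hp.tail (.inr ⟨rfl, hu.symm⟩)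

/-! ### Evaluating a decoupling on the orbit -/

lemma kernelPoly_eq (w : WeightedModel) :
    kernelPoly w = X 0 ^ mX w * X 1 ^ mY w - X 2 * numPoly 0 1 w := rfl

lemma rename_numPoly {σ τ : Type*} (f : σ → τ) (i j : σ) (w : WeightedModel) :
    rename f (numPoly i j w) = numPoly (f i) (f j) w := by
  simp only [numPoly, Finsupp.sum, map_sum, map_mul, map_pow, rename_X, rename_C]

lemma numPoly_transpose {σ : Type*} (i j : σ) (w : WeightedModel) :
    numPoly j i (transpose w) = numPoly i j w := by
  unfold numPoly
  rw [sum_transpose, mX_transpose, mY_transpose]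
  exact Finsupp.sum_congr fun s _ => mul_right_comm _ _ _

lemma isRelPrime_X_of_coeff_ne_zero {k ι : Type*} [Field k] {i : ι} {P : MvPolynomial ι k}
    {m : ι →₀ ℕ} (hm : m i = 0) (hcoeff : coeff m P ≠ 0) : IsRelPrime (X i) P := by
  classical
  rw [X_prime.irreducible.isRelPrime_iff_not_dvd]
  rintro ⟨Q, rfl⟩
  rw [coeff_X_mul', if_neg (by rwa [Finsupp.notMem_support_iff])] at hcoeff
  exact hcoeff rfl

lemma isRelPrime_X_pow_mY_numPoly {σ : Type*} {i j : σ} (hij : i ≠ j) (w : WeightedModel) :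
    IsRelPrime (X j ^ mY w) (numPoly i j w) := by
  rcases Nat.eq_zero_or_pos (mY w) with h | h
  · rw [h, pow_zero]
    exact isRelPrime_one_left
  · obtain ⟨s, hs, hs1⟩ := exists_snd_eq_neg_mY h
    refine (isRelPrime_X_of_coeff_ne_zero ?_ ((coeff_numPoly hij w hs).trans_ne
      (Finsupp.mem_support_iff.1 hs))).pow_left
    simp [hs1, hij]

lemma isRelPrime_kernelPoly_numPoly (w : WeightedModel) :
    IsRelPrime (kernelPoly w) (numPoly 0 1 w) := by
  have hX : IsRelPrime ((X 0 : Poly3) ^ mX w) (numPoly 0 1 w) := by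
    rw [← numPoly_transpose, ← mY_transpose]
    exact isRelPrime_X_pow_mY_numPoly one_ne_zero _
  intro d hd hN
  refine hX.mul_left (isRelPrime_X_pow_mY_numPoly zero_ne_one w) ?_ hN
  rw [kernelPoly_eq] at hd
  exact (dvd_sub_left (hN.mul_left _)).1 hd

-- Modulo the kernel polynomial `X ^ m_x Y ^ m_y = t N` for `N = X ^ m_x Y ^ m_y S`, so that every
-- occurrence of `t` can be eliminated at the cost of a factor `N`.
lemma exists_numPoly_pow_mul_eq (w : WeightedModel) (B : Poly3) :
    ∃ (n : ℕ) (B' : MvPolynomial (Fin 2) ℂ) (Q : Poly3),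
      numPoly 0 1 w ^ n * B = rename ![0, 1] B' + kernelPoly w * Q := by
  have hN : rename ![0, 1] (numPoly (0 : Fin 2) 1 w) = numPoly (0 : Fin 3) 1 w :=
    rename_numPoly _ _ _ w
  induction B using MvPolynomial.induction_on with
  | C a => exact ⟨0, C a, 0, by rw [rename_C]; ring⟩
  | add P P' hP hP' =>
    obtain ⟨n, B, Q, h⟩ := hP
    obtain ⟨n', B', Q', h'⟩ := hP'
    refine ⟨n + n', numPoly 0 1 w ^ n' * B + numPoly 0 1 w ^ n * B',
      numPoly 0 1 w ^ n' * Q + numPoly 0 1 w ^ n * Q', ?_⟩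
    simp only [map_add, map_mul, map_pow, hN]
    linear_combination numPoly 0 1 w ^ n' * h + numPoly 0 1 w ^ n * h'
  | mul_X P i hP =>
    obtain ⟨n, B, Q, h⟩ := hP
    have h0 : rename ![0, 1] (X 0 : MvPolynomial (Fin 2) ℂ) = (X 0 : Poly3) := rename_X _ _
    have h1 : rename ![0, 1] (X 1 : MvPolynomial (Fin 2) ℂ) = (X 1 : Poly3) := rename_X _ _
    obtain rfl | rfl | rfl : i = 0 ∨ i = 1 ∨ i = 2 := by fin_cases i <;> simp
    · exact ⟨n, B * X 0, Q * X 0, by rw [map_mul, h0]; linear_combination X 0 * h⟩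
    · exact ⟨n, B * X 1, Q * X 1, by rw [map_mul, h1]; linear_combination X 1 * h⟩
    · refine ⟨n + 1, B * (X 0 ^ mX w * X 1 ^ mY w),
        Q * (X 0 ^ mX w * X 1 ^ mY w) - (rename ![0, 1] B + kernelPoly w * Q), ?_⟩
      simp only [map_mul, map_pow, h0, h1]
      linear_combination X 2 * numPoly 0 1 w * h +
        (rename ![0, 1] B + kernelPoly w * Q) * kernelPoly_eq w

lemma aeval_rename_pair {k A σ : Type*} [CommSemiring k] [CommSemiring A] [Algebra k A]
    (f : σ → A) (i j : σ) (P : MvPolynomial (Fin 2) k) :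
    aeval f (rename ![i, j] P) = aeval ![f i, f j] P := by
  rw [aeval_rename]
  congr 2
  ext l
  fin_cases l <;> rfl

/-- Evaluation of a polynomial in `X, Y, t` at `(u, v, τ)` for `p = (u, v)`. -/
def evalAt (p : KKˣ × KKˣ) (τ : KK) : Poly3 →ₐ[ℂ] KK := aeval ![(p.1 : KK), p.2, τ]

lemma evalAt_kernelPoly (w : WeightedModel) (p : KKˣ × KKˣ) (τ : KK) :
    evalAt p τ (kernelPoly w) =
      (p.1 : KK) ^ mX w * (p.2 : KK) ^ mY w * (1 - τ * stepEval w p) := by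
  rw [kernelPoly_eq, map_sub, map_mul, map_mul, map_pow, map_pow]
  unfold evalAt
  rw [aeval_numPoly w (f := ![(p.1 : KK), p.2, τ]) rfl rfl]
  simp only [aeval_X, Matrix.cons_val]
  ring

namespace Generic

variable {w : WeightedModel} {p : KKˣ × KKˣ}

lemma evalAt_kernelPoly_eq_zero (hp : Generic p) (hw : w ≠ 0) :
    evalAt p (stepEval w p)⁻¹ (kernelPoly w) = 0 := by
  rw [evalAt_kernelPoly, inv_mul_cancel₀ (hp.stepEval_ne_zero hw), sub_self, mul_zero]

lemma kernelPoly_dvd (hp : Generic p) (hw : w ≠ 0) {B : Poly3}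
    (hB : evalAt p (stepEval w p)⁻¹ B = 0) : kernelPoly w ∣ B := by
  obtain ⟨n, B', Q, h⟩ := exists_numPoly_pow_mul_eq w B
  have heval := congrArg (evalAt p (stepEval w p)⁻¹) h
  rw [map_mul, hB, mul_zero, map_add, map_mul, hp.evalAt_kernelPoly_eq_zero hw, zero_mul, add_zero,
    evalAt, aeval_rename_pair] at heval
  rw [algebraicIndependent_iff.1 hp B' heval.symm, map_zero, zero_add] at h
  exact (isRelPrime_kernelPoly_numPoly w).pow_right.dvd_of_dvd_mul_left ⟨Q, h⟩

lemma algebraicIndependent_fst_inv_stepEval (hp : Generic p) (hw : ∃ s ∈ w.support, s.2 ≠ 0) :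
    AlgebraicIndependent ℂ ![(p.1 : KK), (stepEval w p)⁻¹] :=
  (algebraicIndependent_pair_iff _ _).2 ⟨(generic_iff.1 hp).1, fun halg =>
    hp.transcendental_stepEval hw (inv_inv (stepEval w p) ▸ halg.inv)⟩

lemma algebraicIndependent_snd_inv_stepEval (hp : Generic p) (hw : ∃ s ∈ w.support, s.1 ≠ 0) :
    AlgebraicIndependent ℂ ![(p.2 : KK), (stepEval w p)⁻¹] :=
  stepEval_transpose_swap w p ▸ hp.swap.algebraicIndependent_fst_inv_stepEval
    (exists_mem_support_transpose_snd_ne_zero hw)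

end Generic

lemma exists_rename_mul_eq_of_mem_adjoin {k ι κ : Type*} [Field k] {a : ι → κ}
    {H : FractionRing (MvPolynomial κ k)}
    (hH : H ∈ IntermediateField.adjoin k (Set.range fun i =>
      algebraMap (MvPolynomial κ k) (FractionRing (MvPolynomial κ k)) (X (a i)))) :
    ∃ P Q : MvPolynomial ι k, Q ≠ 0 ∧
      H * algebraMap _ (FractionRing (MvPolynomial κ k)) (rename a Q) =
        algebraMap _ _ (rename a P) := by
  have haeval (P : MvPolynomial ι k) : aeval (fun i =>
      algebraMap (MvPolynomial κ k) (FractionRing (MvPolynomial κ k)) (X (a i))) P =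
        algebraMap _ _ (rename a P) := by
    have hX := aeval_algebraMap_apply (R := k) (FractionRing (MvPolynomial κ k))
      (X : κ → MvPolynomial κ k) (rename a P)
    rwa [aeval_X_left_apply, Function.comp_def, aeval_rename] at hX
  obtain ⟨P, Q, h⟩ := (IntermediateField.mem_adjoin_range_iff k _ _).1 hH
  rw [haeval, haeval] at h
  by_cases hQ : algebraMap _ (FractionRing (MvPolynomial κ k)) (rename a Q) = 0
  · exact ⟨0, 1, one_ne_zero, by rw [h, hQ, div_zero, zero_mul, map_zero, map_zero]⟩
  · exact ⟨P, Q, fun h0 => hQ (by rw [h0, map_zero, map_zero]), by rw [h, div_mul_cancel₀ _ hQ]⟩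

lemma exists_rename_mul_eq_of_mem_adjoin_pair {k κ : Type*} [Field k] {i j : κ}
    {H : FractionRing (MvPolynomial κ k)}
    (hH : H ∈ IntermediateField.adjoin k
      {algebraMap (MvPolynomial κ k) (FractionRing (MvPolynomial κ k)) (X i),
        algebraMap (MvPolynomial κ k) (FractionRing (MvPolynomial κ k)) (X j)}) :
    ∃ P Q : MvPolynomial (Fin 2) k, Q ≠ 0 ∧
      H * algebraMap _ (FractionRing (MvPolynomial κ k)) (rename ![i, j] Q) =
        algebraMap _ _ (rename ![i, j] P) := by
  refine exists_rename_mul_eq_of_mem_adjoin ?_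
  convert hH
  ext z
  simp [Fin.exists_fin_two, eq_comm]

lemma HasGaloisDecoupling.exists_polynomial_identity {w : WeightedModel} {P : Poly3}
    (h : HasGaloisDecoupling w (algebraMap Poly3 Frac3 P)) :
    ∃ (F₁ F₂ G₁ G₂ : MvPolynomial (Fin 2) ℂ) (A B : Poly3),
      F₂ ≠ 0 ∧ G₂ ≠ 0 ∧ ¬ kernelPoly w ∣ B ∧
        P * rename ![0, 2] F₂ * rename ![1, 2] G₂ * B =
          rename ![0, 2] F₁ * rename ![1, 2] G₂ * B + rename ![1, 2] G₁ * rename ![0, 2] F₂ * B +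
            kernelPoly w * A * rename ![0, 2] F₂ * rename ![1, 2] G₂ := by
  obtain ⟨F, hF, G, hG, R, ⟨A, B, hB0, -, rfl, hB⟩, h⟩ := h
  obtain ⟨F₁, F₂, hF₂, hF⟩ := exists_rename_mul_eq_of_mem_adjoin_pair hF
  obtain ⟨G₁, G₂, hG₂, hG⟩ := exists_rename_mul_eq_of_mem_adjoin_pair hG
  refine ⟨F₁, F₂, G₁, G₂, A, B, hF₂, hG₂, hB, IsFractionRing.injective Poly3 Frac3 ?_⟩
  have hB' : algebraMap Poly3 Frac3 B ≠ 0 := by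
    rwa [Ne, map_eq_zero_iff _ (IsFractionRing.injective Poly3 Frac3)]
  simp only [map_mul, map_add, ← hF, ← hG, h]
  field_simp

/-- The product of the two coordinates is, on `O`, the sum of a function of the first coordinate
and a function of the second one. -/
def DecouplesOn {K : Type*} [Semiring K] (O : Set (Kˣ × Kˣ)) : Prop :=
  ∃ F G : Kˣ → K, ∀ p ∈ O, (p.1 : K) * p.2 = F p.1 + G p.2

lemma IsNotUnivariate.ne_zero {w : WeightedModel} (hw : IsNotUnivariate w) : w ≠ 0 :=
  let ⟨_, hs, _⟩ := hw.1
  Finsupp.support_nonempty_iff.1 ⟨_, hs⟩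

lemma HasGaloisDecoupling.decouplesOn_orbit {w : WeightedModel}
    (h : HasGaloisDecoupling w (fX * fY)) (hw : IsNotUnivariate w) : DecouplesOn (Orbit w) := by
  rw [fX, fY, ← map_mul] at h
  obtain ⟨F₁, F₂, G₁, G₂, A, B, hF₂, hG₂, hB, hpoly⟩ := h.exists_polynomial_identity
  let τ : KK := (stepEval w (xK, yK))⁻¹
  refine ⟨fun u => aeval ![(u : KK), τ] F₁ / aeval ![(u : KK), τ] F₂,
    fun v => aeval ![(v : KK), τ] G₁ / aeval ![(v : KK), τ] G₂, fun p hp => ?_⟩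
  have hgen := hw.generic_of_mem_orbit hp
  have hτ : τ = (stepEval w p)⁻¹ := by rw [stepEval_of_mem_orbit hp]
  have hB_ne : evalAt p τ B ≠ 0 := fun h0 => hB (hgen.kernelPoly_dvd hw.ne_zero (hτ ▸ h0))
  have hF₂_ne : aeval ![(p.1 : KK), τ] F₂ ≠ 0 := fun h0 =>
    hF₂ (algebraicIndependent_iff.1 (hgen.algebraicIndependent_fst_inv_stepEval hw.2) _ (hτ ▸ h0))
  have hG₂_ne : aeval ![(p.2 : KK), τ] G₂ ≠ 0 := fun h0 =>
    hG₂ (algebraicIndependent_iff.1 (hgen.algebraicIndependent_snd_inv_stepEval hw.1) _ (hτ ▸ h0))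
  have hkernel : evalAt p τ (kernelPoly w) = 0 := hτ ▸ hgen.evalAt_kernelPoly_eq_zero hw.ne_zero
  have heval := congrArg (evalAt p τ) hpoly
  rw [evalAt] at heval hB_ne hkernel
  simp only [map_mul, map_add, hkernel, aeval_rename_pair, aeval_X, Matrix.cons_val, zero_mul,
    add_zero] at heval
  field_simp
  refine mul_right_cancel₀ hB_ne ?_
  linear_combination heval

/-- The set contains the four corners of a nondegenerate rectangle with sides parallel to the
axes. -/
def ContainsRectangle {α β : Type*} (O : Set (α × β)) : Prop :=
  ∃ a a' b b', a ≠ a' ∧ b ≠ b' ∧ (a, b) ∈ O ∧ (a, b') ∈ O ∧ (a', b') ∈ O ∧ (a', b) ∈ O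

lemma ContainsRectangle.not_decouplesOn {K : Type*} [CommRing K] [IsDomain K]
    {O : Set (Kˣ × Kˣ)} (h : ContainsRectangle O) : ¬ DecouplesOn O := by
  rintro ⟨F, G, hFG⟩
  obtain ⟨u, u', v, v', hu, hv, h₁, h₂, h₃, h₄⟩ := h
  have hprod : ((u : K) - u') * ((v : K) - v') = 0 := by
    linear_combination hFG _ h₁ - hFG _ h₂ + hFG _ h₃ - hFG _ h₄
  rcases mul_eq_zero.1 hprod with h | h
  · exact hu (Units.ext (sub_eq_zero.1 h))
  · exact hv (Units.ext (sub_eq_zero.1 h))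

/-- The rook's graph: two distinct pairs are joined when they have a coordinate in common. The
orbit of a model is an induced subgraph of the rook's graph on `𝕂ˣ × 𝕂ˣ`. -/
abbrev rookGraph (α β : Type*) : SimpleGraph (α × β) := (⊤ : SimpleGraph α) □ (⊤ : SimpleGraph β)

lemma rookGraph_adj {α β : Type*} {p q : α × β} :
    (rookGraph α β).Adj p q ↔ p ≠ q ∧ (p.1 = q.1 ∨ p.2 = q.2) := by
  simp only [SimpleGraph.boxProd_adj, SimpleGraph.top_adj, ne_eq, Prod.ext_iff]
  tauto

lemma rookGraph_mixed_of_not_adj {α β : Type*} {p q r : α × β} (hq : (rookGraph α β).Adj p q)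
    (hr : (rookGraph α β).Adj p r) (hne : q ≠ r) (hqr : ¬ (rookGraph α β).Adj q r) :
    p = (q.1, r.2) ∨ p = (r.1, q.2) := by
  simp only [rookGraph_adj, ne_eq, Prod.ext_iff] at *
  grind

lemma orbitGraph_adj {w : WeightedModel} {p q : Orbit w} :
    (orbitGraph w).Adj p q ↔ (rookGraph KKˣ KKˣ).Adj p.1 q.1 := by
  have h : stepEval w p.1 = stepEval w q.1 :=
    (stepEval_of_mem_orbit p.2).trans (stepEval_of_mem_orbit q.2).symm
  simp only [rookGraph_adj, orbitGraph, SimpleGraph.fromRel_adj, Adjacent, XAdjacent, YAdjacent, h,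
    and_true, eq_comm (a := q.1.1), eq_comm (a := q.1.2), or_self, ne_eq, Subtype.ext_iff]

lemma cycleGraph_four_isIndContained_orbitGraph_iff {w : WeightedModel} :
    (SimpleGraph.cycleGraph 4).IsIndContained (orbitGraph w) ↔ ContainsRectangle (Orbit w) := by
  constructor
  · rintro ⟨f⟩
    have hadj (i j : Fin 4) : (rookGraph KKˣ KKˣ).Adj (f i).1 (f j).1 ↔
        (SimpleGraph.cycleGraph 4).Adj i j := orbitGraph_adj.symm.trans f.map_adj_iff
    have hne (i j : Fin 4) (hij : i ≠ j) : (f i).1 ≠ (f j).1 :=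
      fun h => hij (f.injective (Subtype.ext h))
    have h02 : (f 0).1.1 ≠ (f 2).1.1 ∧ (f 0).1.2 ≠ (f 2).1.2 := by
      have := (hadj 0 2).not.2 (by decide)
      rw [rookGraph_adj] at this
      exact not_or.1 fun h => this ⟨hne 0 2 (by decide), h⟩
    refine ⟨_, _, _, _, h02.1, h02.2, (f 0).2, ?_⟩
    have mixed (i : Fin 4) (h0 : (SimpleGraph.cycleGraph 4).Adj i 0)
        (h2 : (SimpleGraph.cycleGraph 4).Adj i 2) :=
      rookGraph_mixed_of_not_adj ((hadj i 0).2 h0) ((hadj i 2).2 h2) (hne 0 2 (by decide))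
        ((hadj 0 2).not.2 (by decide))
    rcases mixed 1 (by decide) (by decide) with h1 | h1 <;>
      rcases mixed 3 (by decide) (by decide) with h3 | h3
    · exact absurd (h1.trans h3.symm) (hne 1 3 (by decide))
    · exact ⟨h1 ▸ (f 1).2, (f 2).2, h3 ▸ (f 3).2⟩
    · exact ⟨h3 ▸ (f 3).2, (f 2).2, h1 ▸ (f 1).2⟩
    · exact absurd (h1.trans h3.symm) (hne 1 3 (by decide))
  · rintro ⟨a, a', b, b', ha, hb, h₁, h₂, h₃, h₄⟩
    let f : Fin 4 → Orbit w := ![⟨_, h₁⟩, ⟨_, h₂⟩, ⟨_, h₃⟩, ⟨_, h₄⟩]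
    refine ⟨⟨⟨f, fun i j => ?_⟩, fun {i j} => ?_⟩⟩
    · fin_cases i <;> fin_cases j <;> simp [f, ha, hb, ha.symm, hb.symm]
    · change (orbitGraph w).Adj (f i) (f j) ↔ _
      rw [orbitGraph_adj, rookGraph_adj]
      fin_cases i <;> fin_cases j <;> first
        | exact iff_of_true (by simp [f, ha, hb, ha.symm, hb.symm]) (by decide)
        | exact iff_of_false (by simp [f, ha, hb, ha.symm, hb.symm]) (by decide)

lemma not_hasGaloisDecoupling_of_containsRectangle {w : WeightedModel} (hw : IsNotUnivariate w)
    (h : ContainsRectangle (Orbit w)) : ¬ HasGaloisDecoupling w (fX * fY) :=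
  fun hdec => h.not_decouplesOn (hdec.decouplesOn_orbit hw)

lemma HasOrbitType.not_hasGaloisDecoupling {w : WeightedModel} {V : Type*} {Γ : SimpleGraph V}
    (hΓ : HasOrbitType w Γ) (hw : IsNotUnivariate w)
    (hsquare : (SimpleGraph.cycleGraph 4).IsIndContained Γ) :
    ¬ HasGaloisDecoupling w (fX * fY) :=
  let ⟨e⟩ := hΓ
  not_hasGaloisDecoupling_of_containsRectangle hw
    (cycleGraph_four_isIndContained_orbitGraph_iff.1 (hsquare.trans ⟨e.symm.toEmbedding⟩))

lemma cycleGraph_four_isIndContained_O12tilde :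
    (SimpleGraph.cycleGraph 4).IsIndContained O12tilde := by
  let f : Fin 4 → {p : Fin 4 × Fin 4 // p.1 ≠ p.2} :=
    ![⟨(0, 2), by decide⟩, ⟨(0, 3), by decide⟩, ⟨(1, 3), by decide⟩, ⟨(1, 2), by decide⟩]
  refine ⟨⟨⟨f, by decide⟩, fun {i j} => ?_⟩⟩
  change O12tilde.Adj (f i) (f j) ↔ _
  rw [O12tilde, SimpleGraph.fromRel_adj]
  revert i j
  decide

/-! ### Hadamard models and fans -/

lemma degreeOf_one_kernelPoly_le (w : WeightedModel) :
    (kernelPoly w).degreeOf 1 ≤ mY w + maxY w := by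
  have hX0 (k : ℕ) : ((X 0 : Poly3) ^ k).degreeOf 1 = 0 :=
    degreeOf_X_pow_of_ne _ (by decide)
  have hX1 (k : ℕ) : ((X 1 : Poly3) ^ k).degreeOf 1 ≤ k := (degreeOf_X_self_pow _ _).le
  have hX2 : (X 2 : Poly3).degreeOf 1 = 0 := degreeOf_X_of_ne (by decide)
  rw [kernelPoly_eq]
  refine (degreeOf_sub_le _ _ _).trans (max_le ?_ ?_)
  · have hmul := degreeOf_mul_le 1 ((X 0 : Poly3) ^ mX w) (X 1 ^ mY w)
    have := hX0 (mX w)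
    have := hX1 (mY w)
    omega
  · refine (degreeOf_mul_le _ _ _).trans ?_
    rw [hX2, zero_add]
    refine (degreeOf_sum_le _ _ _).trans (Finset.sup_le fun s hs => ?_)
    have hmul := degreeOf_mul_le 1 (C (w s) * (X 0 : Poly3) ^ (s.1 + mX w).toNat)
      (X 1 ^ (s.2 + mY w).toNat)
    have hC := degreeOf_C_mul_le ((X 0 : Poly3) ^ (s.1 + mX w).toNat) 1 (w s)
    have := hX0 (s.1 + mX w).toNat
    have := hX1 (s.2 + mY w).toNat
    have := snd_le_maxY hs
    have := snd_add_mY_nonneg hs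
    exact hmul.trans (by omega)

lemma kernelPoly_transpose (w : WeightedModel) :
    kernelPoly (transpose w) = rename (Equiv.swap 0 1) (kernelPoly w) := by
  rw [kernelPoly_eq, kernelPoly_eq, mX_transpose, mY_transpose, numPoly_transpose]
  simp only [map_sub, map_mul, map_pow, rename_X, rename_numPoly, Equiv.swap_apply_left,
    Equiv.swap_apply_right, mul_comm (X 0 ^ mY w : Poly3)]
  rw [Equiv.swap_apply_of_ne_of_ne (by decide) (by decide)]

lemma degreeOf_zero_kernelPoly_le (w : WeightedModel) :
    (kernelPoly w).degreeOf 0 ≤ mX w + maxX w := by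
  rw [← mY_transpose, ← maxY_transpose,
    ← degreeOf_rename_of_injective (Equiv.swap (0 : Fin 3) 1).injective 0, ← kernelPoly_transpose]
  exact degreeOf_one_kernelPoly_le _

lemma exists_mem_support_snd_ne_zero {w : WeightedModel} (h : 0 < mY w + maxY w) :
    ∃ s ∈ w.support, s.2 ≠ 0 := by
  by_contra! h0
  have hmY : mY w = 0 := Finset.sup_eq_bot_iff _ _ |>.2 fun s hs => by simp [h0 s hs]
  have hmaxY : maxY w = 0 := Finset.sup_eq_bot_iff _ _ |>.2 fun s hs => by simp [h0 s hs]
  omega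

lemma exists_mem_support_fst_ne_zero {w : WeightedModel} (h : 0 < mX w + maxX w) :
    ∃ s ∈ w.support, s.1 ≠ 0 := by
  rw [← mY_transpose, ← maxY_transpose] at h
  obtain ⟨s, hs, hs0⟩ := exists_mem_support_snd_ne_zero h
  exact ⟨s.swap, mem_support_transpose.1 hs, hs0⟩

lemma IsHadamard.isNotUnivariate {w : WeightedModel} (h : IsHadamard w) : IsNotUnivariate w :=
  ⟨exists_mem_support_fst_ne_zero
      (zero_lt_one.trans (h.2.1.trans_le (degreeOf_zero_kernelPoly_le w))),
    exists_mem_support_snd_ne_zero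
      (zero_lt_one.trans (h.2.2.trans_le (degreeOf_one_kernelPoly_le w)))⟩

/-- The value of a Laurent polynomial in one variable, given by its coefficients. -/
def laurentEval (P : ℤ →₀ ℂ) (u : KKˣ) : KK :=
  P.sum fun i c => algebraMap ℂ KK c * ((u ^ i : KKˣ) : KK)

lemma laurentEval_eq_sum (P : ℤ →₀ ℂ) {A : Finset ℤ} (hA : P.support ⊆ A) (u : KKˣ) :
    laurentEval P u = ∑ i ∈ A, algebraMap ℂ KK (P i) * ((u ^ i : KKˣ) : KK) :=
  Finsupp.sum_of_support_subset _ hA _ fun _ _ => by rw [map_zero, zero_mul]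

lemma stepEval_hadamard {w : WeightedModel} {P Q R : ℤ →₀ ℂ}
    (h : ∀ i j : ℤ, w (i, j) = P i * Q j + if j = 0 then R i else 0) (p : KKˣ × KKˣ) :
    stepEval w p = laurentEval P p.1 * laurentEval Q p.2 + laurentEval R p.1 := by
  classical
  have hsupp : w.support ⊆ (P.support ∪ R.support) ×ˢ insert 0 Q.support := by
    rintro ⟨i, j⟩ hij
    rw [Finsupp.mem_support_iff, h] at hij
    simp only [Finset.mem_product, Finset.mem_union, Finset.mem_insert, Finsupp.mem_support_iff]
    grind
  unfold stepEval
  rw [Finsupp.sum_of_support_subset w hsupp _ fun _ _ => by rw [map_zero, zero_mul, zero_mul],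
    laurentEval_eq_sum P Finset.subset_union_left, laurentEval_eq_sum R Finset.subset_union_right,
    laurentEval_eq_sum Q (Finset.subset_insert 0 Q.support), Finset.sum_product,
    Finset.sum_mul, ← Finset.sum_add_distrib]
  refine Finset.sum_congr rfl fun i _ => ?_
  simp only [h, map_add, add_mul, Finset.sum_add_distrib, Finset.mul_sum,
    apply_ite (algebraMap ℂ KK), map_zero, ite_mul, zero_mul, Finset.sum_ite_eq',
    Finset.mem_insert_self, if_true, zpow_zero, Units.val_one, mul_one, map_mul]
  congr 1
  exact Finset.sum_congr rfl fun j _ => by ring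

lemma IsHadamard.containsRectangle_orbit {w : WeightedModel} (h : IsHadamard w) :
    ContainsRectangle (Orbit w) := by
  have hnu := h.isNotUnivariate
  obtain ⟨⟨P, Q, R, hw⟩, hX, hY⟩ := h
  obtain ⟨x', hx', hxx'⟩ := Set.exists_ne_of_one_lt_ncard
    ((hX.trans_le (degreeOf_zero_kernelPoly_le w)).trans_eq
      (generic_xK_yK.ncard_fibreX hnu.1).symm) xK
  obtain ⟨y', hy', hyy'⟩ := Set.exists_ne_of_one_lt_ncard
    ((hY.trans_le (degreeOf_one_kernelPoly_le w)).trans_eq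
      (generic_xK_yK.ncard_fibreY hnu.2).symm) yK
  have hxy : (xK, yK) ∈ Orbit w := Relation.ReflTransGen.refl
  have hx'y := mem_orbit_of_mem_fibreX hxy hx'
  have hP : laurentEval P xK ≠ 0 := fun h0 =>
    have hconst : stepEval w (xK, yK) = stepEval w (xK, 1) := by
      rw [stepEval_hadamard hw, stepEval_hadamard hw, h0, zero_mul, zero_mul]
    (generic_iff.1 (generic_xK_yK.of_stepEval_eq (q := (xK, 1)) hnu.2 rfl hconst)).2 isAlgebraic_one
  have hQ : laurentEval Q y' = laurentEval Q yK := by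
    rw [fibreY, Set.mem_ofPred, stepEval_hadamard hw, stepEval_hadamard hw] at hy'
    exact mul_left_cancel₀ hP (add_right_cancel hy')
  refine ⟨_, _, _, _, hxx'.symm, hyy'.symm, hxy, mem_orbit_of_mem_fibreY hxy hy',
    mem_orbit_of_mem_fibreY hx'y ?_, hx'y⟩
  change stepEval w (x', y') = stepEval w (x', yK)
  rw [stepEval_hadamard hw, stepEval_hadamard hw, hQ]

lemma fan_apply_natCast {p : ℕ} (z : ℕ → ℂ) {a b : ℕ} (h : a + b ≤ p) :
    fan p z ((a : ℤ), (b : ℤ)) = z (a + b) := by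
  classical
  simp only [fan, Finsupp.add_apply, Finsupp.finsetSum_apply, Finsupp.single_apply, Prod.mk.injEq]
  rw [if_neg (by omega), zero_add, Finset.sum_eq_single_of_mem (a + b) (by grind),
    Finset.sum_eq_single_of_mem a (by grind), if_pos ⟨rfl, by omega⟩]
  · exact fun j _ hj => if_neg (by omega)
  · exact fun i _ hi => Finset.sum_eq_zero fun j _ => if_neg (by omega)

lemma fan_apply_neg_one (p : ℕ) (z : ℕ → ℂ) : fan p z (-1, -1) = 1 := by
  classical
  simp only [fan, Finsupp.add_apply, Finsupp.finsetSum_apply, Finsupp.single_apply, Prod.mk.injEq]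
  rw [if_pos trivial, Finset.sum_eq_zero, add_zero]
  exact fun i _ => Finset.sum_eq_zero fun j _ => if_neg (by omega)

lemma exists_sub_mul_stepEval_fan_eq_sub (p : ℕ) (z : ℕ → ℂ) :
    ∃ g : KKˣ → KK, ∀ u v : KKˣ, ((u : KK) - v) * stepEval (fan p z) (u, v) = g u - g v := by
  refine ⟨fun u => ∑ i ∈ Finset.range (p + 1), algebraMap ℂ KK (z i) * (u : KK) ^ (i + 1) -
    (u : KK)⁻¹, fun u v => ?_⟩
  have hgeom (i : ℕ) : ((u : KK) - v) * ∑ j ∈ Finset.range (i + 1),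
      stepEval (Finsupp.single ((j : ℤ), (i : ℤ) - (j : ℤ)) (z i)) (u, v) =
        algebraMap ℂ KK (z i) * (u : KK) ^ (i + 1) -
          algebraMap ℂ KK (z i) * (v : KK) ^ (i + 1) := by
    rw [← mul_sub, ← geom_sum₂_mul (u : KK) (v : KK) (i + 1), Finset.sum_mul, Finset.mul_sum,
      Finset.mul_sum]
    refine Finset.sum_congr rfl fun j hj => ?_
    rw [Finset.mem_range] at hj
    rw [stepEval_single, show (i : ℤ) - j = ((i + 1 - 1 - j : ℕ) : ℤ) by omega]
    simp only [zpow_natCast, Units.val_pow_eq_pow_val]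
    ring
  rw [fan, stepEval_add, stepEval_sum, mul_add, Finset.mul_sum]
  simp only [stepEval_sum, hgeom, Finset.sum_sub_distrib]
  rw [stepEval_single]
  simp only [map_one, zpow_neg, zpow_one, Units.val_inv_eq_inv_val]
  field_simp
  ring

lemma stepEval_fan_eq_of_stepEval_fan_eq {p : ℕ} {z : ℕ → ℂ} {u v c : KKˣ} (hvc : c ≠ v)
    (h : stepEval (fan p z) (u, c) = stepEval (fan p z) (u, v)) :
    stepEval (fan p z) (v, c) = stepEval (fan p z) (u, c) := by
  obtain ⟨g, hg⟩ := exists_sub_mul_stepEval_fan_eq_sub p z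
  refine mul_left_cancel₀ (sub_ne_zero.2 fun h => hvc (Units.ext h.symm) : (v : KK) - c ≠ 0) ?_
  linear_combination hg v c - hg u c + hg u v + ((u : KK) - v) * h

lemma isNotUnivariate_fan {p : ℕ} {z : ℕ → ℂ} : IsNotUnivariate (fan p z) := by
  have hmem : ((-1 : ℤ), (-1 : ℤ)) ∈ (fan p z).support := by
    rw [Finsupp.mem_support_iff, fan_apply_neg_one]
    exact one_ne_zero
  exact ⟨⟨_, hmem, by decide⟩, ⟨_, hmem, by decide⟩⟩

lemma two_lt_ncard_fibreY_fan {p : ℕ} {z : ℕ → ℂ} (hp : 2 ≤ p) (hz : z p ≠ 0) :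
    2 < (fibreY (fan p z) (xK, yK)).ncard := by
  have hneg : ((-1 : ℤ), (-1 : ℤ)) ∈ (fan p z).support := by
    rw [Finsupp.mem_support_iff, fan_apply_neg_one]
    exact one_ne_zero
  have hpos : (((0 : ℕ) : ℤ), (p : ℤ)) ∈ (fan p z).support := by
    rwa [Finsupp.mem_support_iff, fan_apply_natCast z (by omega), zero_add]
  rw [generic_xK_yK.ncard_fibreY isNotUnivariate_fan.2]
  have := snd_add_mY_nonneg hneg
  have := snd_le_maxY hpos
  grind

lemma xK_ne_yK : xK ≠ yK := fun h =>
  (generic_iff.1 generic_xK_yK).2 (h ▸ isAlgebraic_adjoin_self (xK : KK))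

lemma containsRectangle_orbit_fan {p : ℕ} {z : ℕ → ℂ} (hp : 2 ≤ p) (hz : z p ≠ 0) :
    ContainsRectangle (Orbit (fan p z)) := by
  have hcard : 1 < (fibreY (fan p z) (xK, yK) \ {yK}).ncard := by
    have := two_lt_ncard_fibreY_fan hp hz
    have := Set.pred_ncard_le_ncard_sdiff_singleton (fibreY (fan p z) (xK, yK)) yK
    omega
  obtain ⟨a, b, ⟨ha, hay⟩, ⟨hb, hby⟩, hab⟩ :=
    (Set.one_lt_ncard_iff (Set.finite_of_ncard_pos (by omega))).1 hcard
  have hmem {c : KKˣ} (hc : c ∈ fibreY (fan p z) (xK, yK)) : (xK, c) ∈ Orbit (fan p z) :=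
    mem_orbit_of_mem_fibreY (p := (xK, yK)) Relation.ReflTransGen.refl hc
  exact ⟨xK, yK, a, b, xK_ne_yK, hab, hmem ha, hmem hb,
    mem_orbit_of_mem_fibreX (hmem hb) (stepEval_fan_eq_of_stepEval_fan_eq hby hb),
    mem_orbit_of_mem_fibreX (hmem ha) (stepEval_fan_eq_of_stepEval_fan_eq hay ha)⟩

/-! ### Determinants attached to a grid of roots -/

section Interpolation

variable {K : Type*} [Field K] {n : ℕ}

lemma eval_eq_coeff_mul_nodal_add_sum_basis {P : Polynomial K} (hP : P.natDegree ≤ n)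
    {a : Fin n → K} (ha : Function.Injective a) (s : K) :
    P.eval s = P.coeff n * (Lagrange.nodal Finset.univ a).eval s +
      ∑ i, P.eval (a i) * (Lagrange.basis Finset.univ a i).eval s := by
  have hdegree : (Lagrange.nodal Finset.univ a).natDegree = n := by
    rw [Lagrange.natDegree_nodal, Finset.card_univ, Fintype.card_fin]
  have hleading : (Lagrange.nodal Finset.univ a).coeff n = 1 := by
    have hmonic : (Lagrange.nodal Finset.univ a).Monic := Lagrange.nodal_monic
    rw [← hmonic.coeff_natDegree, hdegree]
  set Q := P - Polynomial.C (P.coeff n) * Lagrange.nodal Finset.univ a with hQ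
  have hlt : Q.degree < (Finset.univ : Finset (Fin n)).card := by
    rw [Finset.card_univ, Fintype.card_fin, Polynomial.degree_lt_iff_coeff_zero]
    intro m hm
    rw [hQ, Polynomial.coeff_sub, Polynomial.coeff_C_mul]
    rcases hm.eq_or_lt with rfl | hm
    · rw [hleading, mul_one, sub_self]
    · rw [Polynomial.coeff_eq_zero_of_natDegree_lt (hP.trans_lt hm),
        Polynomial.coeff_eq_zero_of_natDegree_lt (hdegree.trans_lt hm), mul_zero, sub_zero]
  have hinterpolate := congrArg (Polynomial.eval s)
    (Lagrange.eq_interpolate_of_eval_eq (r := fun i => P.eval (a i)) ha.injOn hlt fun i hi => by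
      rw [hQ, Polynomial.eval_sub, Polynomial.eval_mul, Lagrange.eval_nodal_at_node hi, mul_zero,
        sub_zero])
  simp only [hQ, Lagrange.interpolate_apply, Polynomial.eval_sub, Polynomial.eval_mul,
    Polynomial.eval_C, Polynomial.eval_finsetSum] at hinterpolate
  linear_combination hinterpolate

lemma exists_eq_mul_add_mul_of_vanishes_on_grid {E : K → K → K} (hsymm : ∀ s t, E s t = E t s)
    (hpoly : ∀ t, ∃ P : Polynomial K, P.natDegree ≤ n ∧ ∀ s, E s t = P.eval s)
    {a b : Fin n → K} (ha : Function.Injective a) (hb : Function.Injective b)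
    (hE : ∀ i j, E (a i) (b j) = 0) :
    ∃ f g h k : K → K, ∀ s t, E s t = f s * g t + h s * k t := by
  choose P hP heval using hpoly
  have hrow : ∀ i t, E (a i) t = (P (a i)).coeff n * (Lagrange.nodal Finset.univ b).eval t := by
    intro i t
    rw [hsymm, heval, eval_eq_coeff_mul_nodal_add_sum_basis (hP _) hb]
    simp only [← heval, hsymm _ (a i), hE, zero_mul, Finset.sum_const_zero, add_zero]
  refine ⟨fun s => (Lagrange.nodal Finset.univ a).eval s, fun t => (P t).coeff n,
    fun s => ∑ i, (P (a i)).coeff n * (Lagrange.basis Finset.univ a i).eval s,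
    fun t => (Lagrange.nodal Finset.univ b).eval t, fun s t => ?_⟩
  rw [heval, eval_eq_coeff_mul_nodal_add_sum_basis (hP _) ha]
  simp only [← heval, hrow, Finset.sum_mul]
  rw [mul_comm]
  exact congrArg _ (Finset.sum_congr rfl fun i _ => by ring)

end Interpolation

section Determinants

variable {R : Type*} [Add R] [Sub R] [Mul R]

/-- The determinant of a symmetric `3 × 3` matrix with the given upper triangle. Like the following
definitions it only uses the operations of `R`, so that it can be evaluated by the kernel when
`R` is `ℤ`. -/
def symDet (e₀₀ e₀₁ e₀₂ e₁₁ e₁₂ e₂₂ : R) : R :=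
  e₀₀ * (e₁₁ * e₂₂ - e₁₂ * e₁₂) + e₀₁ * (e₁₂ * e₀₂ - e₀₁ * e₂₂) + e₀₂ * (e₀₁ * e₁₂ - e₁₁ * e₀₂)

/-- The minors of the `2 × 4` matrix with rows `f` and `g`. -/
def minor (f g : Fin 4 → R) (i j : Fin 4) : R := f i * g j - f j * g i

/-- The determinant of the Bézout matrix of two cubics, as a function of the minors of their
coefficients. For `minor f g` it is the resultant of `∑ i, f i * U ^ i` and `∑ i, g i * U ^ i`
up to sign. -/
def bezoutDet (e : Fin 4 → Fin 4 → R) : R :=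
  symDet (e 1 0) (e 2 0) (e 3 0) (e 3 0 + e 2 1) (e 3 1) (e 3 2)

/-- The resultant with respect to `U` of the cubics `s t A - C` and `(s + t) A + B`, whose common
zeros are the values of `U` for which `A V ^ 2 + B V + C` has the roots `s` and `t`. -/
def rootPairDet (A B C : Fin 4 → R) (s t : R) : R :=
  bezoutDet fun i j => s * t * minor A B i j - (s + t) * minor C A i j - minor C B i j

/-- The determinant of the symmetric matrix of the values of `E` at the points `x`, `y`, `z`. -/
def gramDet (E : R → R → R) (x y z : R) : R :=
  symDet (E x x) (E x y) (E x z) (E y y) (E y z) (E z z)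

end Determinants

section CommRing

variable {R S : Type*} [CommRing R] [CommRing S]

lemma map_gramDet_rootPairDet (φ : R →+* S) (A B C : Fin 4 → R) (x y z : R) :
    φ (gramDet (rootPairDet A B C) x y z) =
      gramDet (rootPairDet (φ ∘ A) (φ ∘ B) (φ ∘ C)) (φ x) (φ y) (φ z) := by
  simp only [gramDet, rootPairDet, bezoutDet, symDet, minor, map_add, map_sub, map_mul,
    Function.comp_apply]

lemma rootPairDet_comm (A B C : Fin 4 → R) (s t : R) :
    rootPairDet A B C s t = rootPairDet A B C t s := by
  rw [rootPairDet, rootPairDet, mul_comm s t, add_comm s t]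

lemma bezoutDet_eq_det (e : Fin 4 → Fin 4 → R) :
    bezoutDet e = Matrix.det
      !![e 1 0, e 2 0, e 3 0; e 2 0, e 3 0 + e 2 1, e 3 1; e 3 0, e 3 1, e 3 2] := by
  rw [Matrix.det_fin_three, bezoutDet, symDet]
  simp only [Matrix.of_apply, Matrix.cons_val]
  ring

lemma exists_polynomial_rootPairDet (A B C : Fin 4 → R) (t : R) :
    ∃ P : Polynomial R, P.natDegree ≤ 3 ∧ ∀ s, rootPairDet A B C s t = P.eval s := by
  let m (i j : Fin 4) : R := t * minor A B i j - minor C A i j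
  let n (i j : Fin 4) : R := -(t * minor C A i j) - minor C B i j
  let M : Matrix (Fin 3) (Fin 3) R :=
    !![m 1 0, m 2 0, m 3 0; m 2 0, m 3 0 + m 2 1, m 3 1; m 3 0, m 3 1, m 3 2]
  let N : Matrix (Fin 3) (Fin 3) R :=
    !![n 1 0, n 2 0, n 3 0; n 2 0, n 3 0 + n 2 1, n 3 1; n 3 0, n 3 1, n 3 2]
  refine ⟨_, Polynomial.natDegree_det_X_add_C_le M N, fun s => ?_⟩
  rw [rootPairDet, bezoutDet_eq_det, ← Polynomial.coe_evalRingHom, RingHom.map_det]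
  congr 1
  ext i j
  fin_cases i <;> fin_cases j <;> simp [M, N, m, n] <;> ring

lemma gramDet_eq_zero_of_rank_le_two {E : R → R → R} (hsymm : ∀ s t, E s t = E t s)
    {f g h k : R → R} (hE : ∀ s t, E s t = f s * g t + h s * k t) (x y z : R) :
    gramDet E x y z = 0 := by
  have hxy := hsymm x y
  have hxz := hsymm x z
  have hyz := hsymm y z
  simp only [gramDet, symDet, hE] at hxy hxz hyz ⊢
  grind

end CommRing

section Field

variable {K : Type*} [Field K]

lemma bezoutDet_minor_eq_zero {f g : Fin 4 → K} {u : K} (hf : ∑ i, f i * u ^ (i : ℕ) = 0)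
    (hg : ∑ i, g i * u ^ (i : ℕ) = 0) : bezoutDet (minor f g) = 0 := by
  simp only [Fin.sum_univ_four, Fin.coe_ofNat_eq_mod, Nat.reduceMod, Nat.zero_mod, Nat.one_mod,
    Nat.mod_succ, pow_zero, pow_one, mul_one] at hf hg
  rw [bezoutDet_eq_det]
  refine Matrix.exists_mulVec_eq_zero_iff.1 ⟨![1, u, u ^ 2], fun h => ?_, ?_⟩
  · exact one_ne_zero (congrFun h 0)
  · ext i
    fin_cases i <;> simp only [Matrix.mulVec, dotProduct, Fin.sum_univ_three, minor,
      Fin.zero_eta, Fin.mk_one, Fin.reduceFinMk, Matrix.of_apply, Matrix.cons_val, Pi.zero_apply]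
    · linear_combination (f 1 + f 2 * u + f 3 * u ^ 2) * hg - (g 1 + g 2 * u + g 3 * u ^ 2) * hf
    · linear_combination (f 2 + f 3 * u) * hg - (g 2 + g 3 * u) * hf
    · linear_combination f 3 * hg - g 3 * hf

lemma rootPairDet_eq_zero {A B C : Fin 4 → K} {u a b : K}
    (hsum : (a + b) * ∑ i, A i * u ^ (i : ℕ) + ∑ i, B i * u ^ (i : ℕ) = 0)
    (hprod : a * b * ∑ i, A i * u ^ (i : ℕ) - ∑ i, C i * u ^ (i : ℕ) = 0) :
    rootPairDet A B C a b = 0 := by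
  have h : bezoutDet (minor (fun i => a * b * A i - C i) fun i => (a + b) * A i + B i) = 0 := by
    refine bezoutDet_minor_eq_zero (u := u) ?_ ?_
    · rw [← hprod, Finset.mul_sum, ← Finset.sum_sub_distrib]
      exact Finset.sum_congr rfl fun i _ => by ring
    · rw [← hsum, Finset.mul_sum, ← Finset.sum_add_distrib]
      exact Finset.sum_congr rfl fun i _ => by ring
  rw [← h, rootPairDet]
  congr 1
  ext i j
  unfold minor
  ring

end Field

/-- The coefficients of the cubic with coefficients `0` and `1` prescribed by `A`, minus `c U`. -/
def shiftedBits {R : Type*} [Zero R] [One R] [Sub R] (A : Fin 4 → Bool) (c : R) (i : Fin 4) : R :=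
  (if A i then 1 else 0) - if i = 1 then c else 0

lemma map_comp_shiftedBits {R S : Type*} [Ring R] [Ring S] (φ : R →+* S) (A : Fin 4 → Bool)
    (c : R) : φ ∘ shiftedBits A c = shiftedBits A (φ c) := by
  ext i
  simp only [shiftedBits, Function.comp_apply, map_sub, apply_ite φ, map_one, map_zero]

lemma sum_shiftedBits_mul_pow {R : Type*} [CommRing R] (A : Fin 4 → Bool) (c u : R) :
    ∑ k, shiftedBits A c k * u ^ (k : ℕ) =
      (if A 0 then 1 else 0) + ((if A 1 then 1 else 0) - c) * u + (if A 2 then 1 else 0) * u ^ 2 +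
        (if A 3 then 1 else 0) * u ^ 3 := by
  simp [Fin.sum_univ_four, shiftedBits]

section Computation

-- The points `0, 1, 3` and the integer `7`, which is substituted for a transcendental number, were
-- found by search: they already single out the exceptional models.

set_option maxRecDepth 100000

lemma gramDet_shiftedBits_seven_top_ne_zero : ∀ A B C : Fin 4 → Bool, (∃ i, A i) →
    (A 0 ∨ B 0 ∨ C 0) → (A 3 ∨ B 3 ∨ C 3) →
      gramDet (rootPairDet (shiftedBits A (0 : ℤ)) (shiftedBits B 0) (shiftedBits C 7)) 0 1 3 ≠
        0 := by
  simp only [Fin.forall_fin_succ_pi, Fin.forall_fin_zero_pi]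
  decide +kernel

lemma eq_of_gramDet_shiftedBits_seven_eq_zero : ∀ A B C : Fin 4 → Bool, (∃ i, A i) → (∃ i, C i) →
    (A 0 ∨ B 0 ∨ C 0) → (A 3 ∨ B 3 ∨ C 3) →
      gramDet (rootPairDet (shiftedBits A (0 : ℤ)) (shiftedBits B 7) (shiftedBits C 0)) 0 1 3 = 0 →
        (B 0 ∧ ¬ B 2 ∧ B 3) ∧
          (A = ![false, false, false, true] ∧ C = ![true, false, false, false] ∨
            A = ![true, false, false, false] ∧ C = ![false, false, false, true]) := by
  simp only [Fin.forall_fin_succ_pi, Fin.forall_fin_zero_pi]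
  decide +kernel

end Computation

lemma gramDet_shiftedBits_specialize {K : Type*} [CommRing K] [Algebra ℤ K] {σ : K}
    (hσ : Transcendental ℤ σ) {A B C : Fin 4 → Bool} {p q : Polynomial ℤ}
    (h : gramDet (rootPairDet (shiftedBits A 0) (shiftedBits B (Polynomial.aeval σ p))
      (shiftedBits C (Polynomial.aeval σ q))) 0 1 3 = 0) (c : ℤ) :
    gramDet (rootPairDet (shiftedBits A 0) (shiftedBits B (p.eval c)) (shiftedBits C (q.eval c)))
      0 1 3 = 0 := by
  have hX : gramDet (rootPairDet (shiftedBits A 0) (shiftedBits B p) (shiftedBits C q)) 0 1 3 =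
      0 := by
    let φ : Polynomial ℤ →+* K := (Polynomial.aeval σ : Polynomial ℤ →ₐ[ℤ] K)
    have hφ : Function.Injective φ := transcendental_iff_injective.1 hσ
    refine hφ ?_
    rw [map_gramDet_rootPairDet]
    simp only [map_comp_shiftedBits, map_zero, map_one, map_ofNat]
    exact h
  have heval := congrArg (Polynomial.evalRingHom c) hX
  rw [map_gramDet_rootPairDet] at heval
  simp only [map_comp_shiftedBits, map_zero, map_one, map_ofNat] at heval
  exact heval

lemma gramDet_shiftedBits_top_ne_zero {K : Type*} [CommRing K] [Algebra ℤ K] {σ : K}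
    (hσ : Transcendental ℤ σ) {A B C : Fin 4 → Bool} (hA : ∃ i, A i)
    (hleft : A 0 ∨ B 0 ∨ C 0) (hright : A 3 ∨ B 3 ∨ C 3) :
    gramDet (rootPairDet (shiftedBits A 0) (shiftedBits B 0) (shiftedBits C σ)) 0 1 3 ≠ 0 := by
  intro hdet
  have hseven := gramDet_shiftedBits_specialize hσ (p := 0) (q := Polynomial.X)
    (by rwa [map_zero, Polynomial.aeval_X]) 7
  rw [Polynomial.eval_zero, Polynomial.eval_X] at hseven
  exact gramDet_shiftedBits_seven_top_ne_zero A B C hA hleft hright hseven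

lemma eq_of_gramDet_shiftedBits_eq_zero {K : Type*} [CommRing K] [Algebra ℤ K] {σ : K}
    (hσ : Transcendental ℤ σ) {A B C : Fin 4 → Bool} (hA : ∃ i, A i) (hC : ∃ i, C i)
    (hleft : A 0 ∨ B 0 ∨ C 0) (hright : A 3 ∨ B 3 ∨ C 3)
    (hdet : gramDet (rootPairDet (shiftedBits A 0) (shiftedBits B σ) (shiftedBits C 0)) 0 1 3 =
      0) :
    (B 0 ∧ ¬ B 2 ∧ B 3) ∧
      (A = ![false, false, false, true] ∧ C = ![true, false, false, false] ∨
        A = ![true, false, false, false] ∧ C = ![false, false, false, true]) := by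
  have hseven := gramDet_shiftedBits_specialize hσ (p := Polynomial.X) (q := 0)
    (by rwa [map_zero, Polynomial.aeval_X]) 7
  rw [Polynomial.eval_zero, Polynomial.eval_X] at hseven
  exact eq_of_gramDet_shiftedBits_seven_eq_zero A B C hA hC hleft hright hseven

/-! ### Orbits of type `𝒪₁₈` -/

lemma O18_adj {x y : (Fin 3 × Fin 3) × Bool} :
    O18.Adj x y ↔ x ≠ y ∧ (x.1 = y.1 ∨ (x.2 = false ∧ y.2 = false ∧ x.1.1 = y.1.1) ∨
      (x.2 = true ∧ y.2 = true ∧ x.1.2 = y.1.2)) := by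
  rw [O18, SimpleGraph.fromRel_adj]
  tauto

lemma rookGraph_fst_eq_iff_snd_eq {α β : Type*} {p q r : α × β} (hq : (rookGraph α β).Adj p q)
    (hr : (rookGraph α β).Adj p r) (hne : q ≠ r) (hqr : ¬ (rookGraph α β).Adj q r) :
    p.1 = q.1 ↔ p.2 = r.2 := by
  simp only [rookGraph_adj, ne_eq, Prod.ext_iff] at *
  grind

lemma fst_eq_and_snd_eq_of_O18_embedding {α β : Type*} (f : O18 ↪g rookGraph α β)
    (h₀ : (f ((0, 0), false)).1 = (f ((0, 0), true)).1) :
    (∀ i j, (f ((i, j), false)).1 = (f ((i, j), true)).1) ∧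
      (∀ i j j', (f ((i, j), false)).2 = (f ((i, j'), false)).2) ∧
        ∀ i i' j, (f ((i, j), true)).2 = (f ((i', j), true)).2 := by
  have split {x y z} (hy : O18.Adj x y) (hz : O18.Adj x z) (hne : y ≠ z) (hyz : ¬ O18.Adj y z) :
      (f x).1 = (f y).1 ↔ (f x).2 = (f z).2 :=
    rookGraph_fst_eq_iff_snd_eq (f.map_adj_iff.2 hy) (f.map_adj_iff.2 hz) (f.injective.ne hne)
      (f.map_adj_iff.not.2 hyz)
  have left_iff {i j j'} (hj : j ≠ j') : (f ((i, j), false)).1 = (f ((i, j), true)).1 ↔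
      (f ((i, j), false)).2 = (f ((i, j'), false)).2 := by
    apply split <;> simp [O18_adj, hj]
  have right_iff {i i' j} (hi : i ≠ i') : (f ((i, j), true)).1 = (f ((i, j), false)).1 ↔
      (f ((i, j), true)).2 = (f ((i', j), true)).2 := by
    apply split <;> simp [O18_adj, hi]
  have edge (i j) : (f ((i, j), false)).1 = (f ((i, j), true)).1 := by
    have edge₀ : (f ((0, j), false)).1 = (f ((0, j), true)).1 := by
      rcases eq_or_ne j 0 with rfl | hj
      · exact h₀
      · exact (left_iff hj).2 ((left_iff hj.symm).1 h₀).symm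
    rcases eq_or_ne i 0 with rfl | hi
    · exact edge₀
    · exact ((right_iff hi).2 ((right_iff hi.symm).1 edge₀.symm).symm).symm
  refine ⟨edge, fun i j j' => ?_, fun i i' j => ?_⟩
  · rcases eq_or_ne j j' with rfl | hj
    exacts [rfl, (left_iff hj).1 (edge i j)]
  · rcases eq_or_ne i i' with rfl | hi
    exacts [rfl, (right_iff hi).1 (edge i j).symm]

/-- A parametrization of a set of pairs by the vertices of `𝒪₁₈`: the first coordinate `U i j` is
attached to the edge `(i, j)` of `K₃₃`, the second coordinates `a i` and `b j` to its endpoints. -/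
structure IsGrid {α β : Type*} (O : Set (α × β)) (U : Fin 3 → Fin 3 → α) (a b : Fin 3 → β) :
    Prop where
  left_mem : ∀ i j, (U i j, a i) ∈ O
  right_mem : ∀ i j, (U i j, b j) ∈ O
  left_injective : Function.Injective a
  right_injective : Function.Injective b
  left_ne_right : ∀ i j, a i ≠ b j
  eq_or_eq : ∀ i j v, (U i j, v) ∈ O → v = a i ∨ v = b j

lemma IsGrid.injective_row {α β : Type*} {O : Set (α × β)} {U : Fin 3 → Fin 3 → α}
    {a b : Fin 3 → β} (h : IsGrid O U a b) (i : Fin 3) : Function.Injective (U i) := fun j j' hj =>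
  (h.eq_or_eq i j' _ (hj ▸ h.right_mem i j)).elim
    (fun hab => absurd hab.symm (h.left_ne_right i j)) fun hb => h.right_injective hb

lemma exists_isGrid_range {α β : Type*} (f : O18 ↪g rookGraph α β)
    (h₀ : (f ((0, 0), false)).1 = (f ((0, 0), true)).1) :
    ∃ U a b, IsGrid (Set.range f) U a b := by
  obtain ⟨edge, left_eq, right_eq⟩ := fst_eq_and_snd_eq_of_O18_embedding f h₀
  have hadj {x y} (hxy : x ≠ y) (h : ¬ O18.Adj x y) :
      (f x).1 ≠ (f y).1 ∧ (f x).2 ≠ (f y).2 := by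
    rw [← f.map_adj_iff, rookGraph_adj] at h
    exact not_or.1 fun h' => h ⟨f.injective.ne hxy, h'⟩
  have hl (i j) : f ((i, j), false) = ((f ((i, j), false)).1, (f ((i, 0), false)).2) :=
    Prod.ext rfl (left_eq i j 0)
  have hr (i j) : f ((i, j), true) = ((f ((i, j), false)).1, (f ((0, j), true)).2) :=
    Prod.ext (edge i j).symm (right_eq i 0 j)
  refine ⟨fun i j => (f ((i, j), false)).1, fun i => (f ((i, 0), false)).2,
    fun j => (f ((0, j), true)).2, fun i j => ⟨_, hl i j⟩, fun i j => ⟨_, hr i j⟩,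
    fun i i' h => ?_, fun j j' h => ?_, fun i j h => ?_, ?_⟩
  · by_contra hne
    exact (hadj (by simp [hne]) (by simp [O18_adj, hne])).2 h
  · by_contra hne
    exact (hadj (by simp [hne]) (by simp [O18_adj, hne])).2 h
  · have heq : f ((i, j), false) = f ((i, j), true) := Prod.ext (edge i j)
      ((left_eq i j 0).trans (h.trans (right_eq 0 i j)))
    simpa using f.injective heq
  · rintro i j v ⟨⟨e, s⟩, hv⟩
    have he : e = (i, j) := by
      by_contra hne
      have hfst : (f (e, s)).1 = (f ((i, j), false)).1 := by rw [hv]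
      cases s
      · exact (hadj (by simp) (by simp [O18_adj, hne])).1 (hfst.trans (edge i j))
      · exact (hadj (by simp) (by simp [O18_adj, hne])).1 hfst
    subst he
    cases s
    · exact .inl (congrArg Prod.snd (hv.symm.trans (hl i j)))
    · exact .inr (congrArg Prod.snd (hv.symm.trans (hr i j)))

lemma HasOrbitType.exists_isGrid {w : WeightedModel} (h : HasOrbitType w O18) :
    ∃ U a b, IsGrid (Orbit w) U a b ∨ IsGrid (Prod.swap ⁻¹' Orbit w) U a b := by
  obtain ⟨e⟩ := h
  let f : O18 ↪g rookGraph KKˣ KKˣ :=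
    ⟨e.symm.toEquiv.toEmbedding.trans (Function.Embedding.subtype _),
      orbitGraph_adj.symm.trans e.symm.map_adj_iff⟩
  have hrange : Set.range f = Orbit w := by
    change Set.range (Subtype.val ∘ e.symm) = _
    rw [Set.range_comp, e.symm.surjective.range_eq, Set.image_univ, Subtype.range_coe]
  have hadj := f.map_adj_iff.2 (O18_adj.2 ⟨by simp, .inl rfl⟩ :
    O18.Adj ((0, 0), false) ((0, 0), true))
  rcases (rookGraph_adj.1 hadj).2 with h | h
  · obtain ⟨U, a, b, hg⟩ := exists_isGrid_range f h
    exact ⟨U, a, b, .inl (hrange ▸ hg)⟩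
  · obtain ⟨U, a, b, hg⟩ := exists_isGrid_range
      ((SimpleGraph.boxProdComm _ _).toEmbedding.comp f) h
    refine ⟨U, a, b, .inr ?_⟩
    rw [← hrange, ← Set.image_swap_eq_preimage_swap, ← Set.range_comp]
    exact hg

lemma unweighted_apply (𝒮 : Finset (ℤ × ℤ)) (s : ℤ × ℤ) :
    unweighted 𝒮 s = if s ∈ 𝒮 then 1 else 0 := by
  classical
  simp only [unweighted, Finsupp.finsetSum_apply, Finsupp.single_apply, Finset.sum_ite_eq']

lemma support_unweighted (𝒮 : Finset (ℤ × ℤ)) : (unweighted 𝒮).support = 𝒮 := by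
  ext s
  simp only [Finsupp.mem_support_iff, unweighted_apply, ne_eq, ite_eq_right_iff, one_ne_zero,
    imp_false, not_not]

lemma transpose_unweighted (𝒮 : Finset (ℤ × ℤ)) :
    transpose (unweighted 𝒮) = unweighted (𝒮.map (Equiv.prodComm ℤ ℤ).toEmbedding) := by
  ext s
  simp only [transpose_apply, unweighted_apply, Finset.mem_map_equiv]
  rfl

/-- Whether `X ^ (k - 1) Y ^ j` occurs in the step polynomial. -/
def stepBit (𝒮 : Finset (ℤ × ℤ)) (j : ℤ) (k : Fin 4) : Bool := decide (((k : ℤ) - 1, j) ∈ 𝒮)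

/-- The coefficients of the cubic polynomial in `u` that is `u` times the coefficient of `V ^ k` in
`fibrePoly (unweighted 𝒮) u σ`, when the steps have first coordinates between `-1` and `2` and
`m = mY (unweighted 𝒮)`. -/
def fibreCubic {R : Type*} [Zero R] [One R] [Sub R] (𝒮 : Finset (ℤ × ℤ)) (m : ℕ) (σ : R) (k : ℕ) :
    Fin 4 → R :=
  shiftedBits (stepBit 𝒮 ((k : ℤ) - m)) (if k = m then σ else 0)

section SmallSteps

variable {𝒮 : Finset (ℤ × ℤ)}

lemma exists_stepBit (h𝒮 : 𝒮 ⊆ Finset.Icc (-1) 2 ×ˢ Finset.Icc (-1) 2) {s : ℤ × ℤ} (hs : s ∈ 𝒮) :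
    ∃ k, stepBit 𝒮 s.2 k ∧ (k : ℤ) - 1 = s.1 := by
  obtain ⟨hmin, hmax⟩ := Finset.mem_Icc.1 (Finset.mem_product.1 (h𝒮 hs)).1
  have hk : ((s.1 + 1).toNat : ℤ) - 1 = s.1 := by omega
  exact ⟨⟨(s.1 + 1).toNat, by omega⟩, by rw [stepBit, decide_eq_true_eq, hk]; exact hs, hk⟩

lemma mul_rowEval_unweighted (h𝒮 : 𝒮 ⊆ Finset.Icc (-1) 2 ×ˢ Finset.Icc (-1) 2) (j : ℤ) (u : KKˣ) :
    (u : KK) * rowEval (unweighted 𝒮) j u =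
      ∑ k, (if stepBit 𝒮 j k then 1 else 0) * (u : KK) ^ (k : ℕ) := by
  simp only [rowEval_eq_sum, Finsupp.sum, support_unweighted, ite_mul, one_mul, zero_mul]
  rw [← Finset.sum_filter, ← Finset.sum_filter, Finset.mul_sum]
  symm
  refine Finset.sum_bij (fun k _ => ((k : ℤ) - 1, j)) (fun k hk => ?_) (fun k _ l _ h => ?_)
    (fun s hs => ?_) fun k hk => ?_
  · exact Finset.mem_filter.2 ⟨of_decide_eq_true (Finset.mem_filter.1 hk).2, rfl⟩
  · rw [Prod.mk.injEq] at h
    omega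
  · obtain ⟨hmem, rfl⟩ := Finset.mem_filter.1 hs
    obtain ⟨k, hk, hks⟩ := exists_stepBit h𝒮 hmem
    exact ⟨k, Finset.mem_filter.2 ⟨Finset.mem_univ _, hk⟩, Prod.ext hks rfl⟩
  · rw [unweighted_apply, if_pos (of_decide_eq_true (Finset.mem_filter.1 hk).2), map_one, one_mul,
      ← Units.val_mul, ← zpow_one_add, add_sub_cancel, zpow_natCast, Units.val_pow_eq_pow_val]

lemma mul_coeff_fibrePoly_unweighted (h𝒮 : 𝒮 ⊆ Finset.Icc (-1) 2 ×ˢ Finset.Icc (-1) 2) (u : KKˣ)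
    (σ : KK) (k : ℕ) :
    (u : KK) * (fibrePoly (unweighted 𝒮) u σ).coeff k =
      ∑ i, fibreCubic 𝒮 (mY (unweighted 𝒮)) σ k i * (u : KK) ^ (i : ℕ) := by
  rw [coeff_fibrePoly, mul_sub, mul_rowEval_unweighted h𝒮]
  simp only [fibreCubic, shiftedBits, sub_mul, Finset.sum_sub_distrib]
  congr 1
  simp only [ite_mul, zero_mul, Finset.sum_ite_eq', Finset.mem_univ, if_true, Fin.val_one, pow_one]
  rw [mul_comm]
  split_ifs <;> simp only [zero_mul]

lemma width_unweighted_le (h𝒮 : 𝒮 ⊆ Finset.Icc (-1) 2 ×ˢ Finset.Icc (-1) 2) :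
    mX (unweighted 𝒮) ≤ 1 ∧ maxX (unweighted 𝒮) ≤ 2 ∧ mY (unweighted 𝒮) ≤ 1 := by
  have hbounds (s) (hs : s ∈ (unweighted 𝒮).support) : -1 ≤ s.1 ∧ s.1 ≤ 2 ∧ -1 ≤ s.2 := by
    obtain ⟨h₁, h₂⟩ := Finset.mem_product.1 (h𝒮 (support_unweighted 𝒮 ▸ hs))
    rw [Finset.mem_Icc] at h₁ h₂
    exact ⟨h₁.1, h₁.2, h₂.1⟩
  refine ⟨Finset.sup_le fun s hs => ?_, Finset.sup_le fun s hs => ?_,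
    Finset.sup_le fun s hs => ?_⟩ <;>
    · have := hbounds s hs
      omega

lemma exists_stepBit_column {s : ℤ × ℤ} (hs : s ∈ 𝒮) {k : Fin 4} (hk : s.1 = (k : ℤ) - 1)
    (hwidth : mY (unweighted 𝒮) + maxY (unweighted 𝒮) = 2) :
    stepBit 𝒮 (2 - mY (unweighted 𝒮)) k ∨ stepBit 𝒮 (1 - mY (unweighted 𝒮)) k ∨
      stepBit 𝒮 (0 - mY (unweighted 𝒮)) k := by
  rw [← support_unweighted 𝒮] at hs
  have hmin := snd_add_mY_nonneg hs
  have hmax := snd_le_maxY hs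
  rw [support_unweighted] at hs
  have hbit {j : ℤ} (hj : s.2 = j) : stepBit 𝒮 j k := decide_eq_true (by rwa [← hk, ← hj])
  obtain h | h | h : s.2 = 2 - mY (unweighted 𝒮) ∨ s.2 = 1 - mY (unweighted 𝒮) ∨
    s.2 = 0 - mY (unweighted 𝒮) := by omega
  exacts [.inl (hbit h), .inr (.inl (hbit h)), .inr (.inr (hbit h))]

end SmallSteps

lemma sum_and_product_of_roots {K : Type*} [Field K] {P : Polynomial K} (hP : P.natDegree ≤ 2)
    {a b : K} (hab : a ≠ b) (ha : P.IsRoot a) (hb : P.IsRoot b) :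
    (a + b) * P.coeff 2 + P.coeff 1 = 0 ∧ a * b * P.coeff 2 - P.coeff 0 = 0 := by
  rw [Polynomial.IsRoot, Polynomial.eval_eq_sum_range' (Nat.lt_succ_of_le hP)] at ha hb
  simp only [Finset.sum_range_succ, Finset.sum_range_zero, pow_zero, pow_one] at ha hb
  constructor <;> refine mul_left_cancel₀ (sub_ne_zero.2 hab) ?_
  · linear_combination ha - hb
  · linear_combination b * ha - a * hb

lemma gramDet_eq_zero_of_grid {K : Type*} [Field K] {A B C : Fin 4 → K} {u : Fin 3 → Fin 3 → K}
    {a b : Fin 3 → K} (ha : Function.Injective a) (hb : Function.Injective b)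
    (hsum : ∀ i j, (a i + b j) * ∑ k, A k * u i j ^ (k : ℕ) + ∑ k, B k * u i j ^ (k : ℕ) = 0)
    (hprod : ∀ i j, a i * b j * ∑ k, A k * u i j ^ (k : ℕ) - ∑ k, C k * u i j ^ (k : ℕ) = 0)
    (x y z : K) : gramDet (rootPairDet A B C) x y z = 0 := by
  obtain ⟨f, g, h, k, hE⟩ := exists_eq_mul_add_mul_of_vanishes_on_grid (rootPairDet_comm A B C)
    (exists_polynomial_rootPairDet A B C) ha hb
    fun i j => rootPairDet_eq_zero (hsum i j) (hprod i j)
  exact gramDet_eq_zero_of_rank_le_two (rootPairDet_comm A B C) hE x y z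

/-- A set of generic points of the level set `S = σ` that contains, with each of its points, all
the points of the level set with the same first coordinate. -/
structure IsFibred (w : WeightedModel) (σ : KK) (O : Set (KKˣ × KKˣ)) : Prop where
  generic : ∀ p ∈ O, Generic p
  stepEval_eq : ∀ p ∈ O, stepEval w p = σ
  mem_of_mem_fibreY : ∀ p ∈ O, ∀ v ∈ fibreY w p, (p.1, v) ∈ O

lemma IsNotUnivariate.isFibred_orbit {w : WeightedModel} (hw : IsNotUnivariate w) :
    IsFibred w (stepEval w (xK, yK)) (Orbit w) where
  generic _ hp := hw.generic_of_mem_orbit hp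
  stepEval_eq _ hp := stepEval_of_mem_orbit hp
  mem_of_mem_fibreY _ hp _ hv := mem_orbit_of_mem_fibreY hp hv

lemma IsNotUnivariate.isFibred_transpose_preimage_swap_orbit {w : WeightedModel}
    (hw : IsNotUnivariate w) :
    IsFibred (transpose w) (stepEval w (xK, yK)) (Prod.swap ⁻¹' Orbit w) where
  generic _ hp := (hw.generic_of_mem_orbit hp).swap
  stepEval_eq _ hp := (stepEval_transpose_swap w _).trans (stepEval_of_mem_orbit hp)
  mem_of_mem_fibreY p hp _ hv :=
    mem_orbit_of_mem_fibreX (p := p.swap) hp (fibreY_transpose_swap w p.swap ▸ hv)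

lemma IsNotUnivariate.transpose {w : WeightedModel} (hw : IsNotUnivariate w) :
    IsNotUnivariate (transpose w) := by
  obtain ⟨hX, s, hs, hs0⟩ := hw
  exact ⟨⟨s.swap, mem_support_transpose.2 (by rwa [Prod.swap_swap]), hs0⟩,
    exists_mem_support_transpose_snd_ne_zero hX⟩

lemma DecouplesOn.preimage_swap {K : Type*} [CommSemiring K] {O : Set (Kˣ × Kˣ)}
    (h : DecouplesOn O) : DecouplesOn (Prod.swap ⁻¹' O) := by
  obtain ⟨F, G, hFG⟩ := h
  exact ⟨G, F, fun p hp => by rw [mul_comm, add_comm]; exact hFG _ hp⟩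

section Grid

variable {w : WeightedModel} {σ : KK} {O : Set (KKˣ × KKˣ)} {U : Fin 3 → Fin 3 → KKˣ}
  {a b : Fin 3 → KKˣ}

lemma IsGrid.mY_add_maxY (h : IsGrid O U a b) (hO : IsFibred w σ O)
    (hw : ∃ s ∈ w.support, s.2 ≠ 0) : mY w + maxY w = 2 := by
  have hfibre : fibreY w (U 0 0, a 0) = {a 0, b 0} := by
    refine Set.Subset.antisymm
      (fun v hv => h.eq_or_eq 0 0 v (hO.mem_of_mem_fibreY _ (h.left_mem 0 0) v hv)) ?_
    rintro v (rfl | rfl)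
    · exact rfl
    · exact (hO.stepEval_eq _ (h.right_mem 0 0)).trans (hO.stepEval_eq _ (h.left_mem 0 0)).symm
  rw [← (hO.generic _ (h.left_mem 0 0)).ncard_fibreY hw, hfibre,
    Set.ncard_pair (h.left_ne_right 0 0)]

lemma IsGrid.three_le_mX_add_maxX (h : IsGrid O U a b) (hO : IsFibred w σ O)
    (hw : ∃ s ∈ w.support, s.1 ≠ 0) : 3 ≤ mX w + maxX w := by
  have hsubset : Set.range (U 0) ⊆ fibreX w (U 0 0, a 0) := by
    rintro _ ⟨j, rfl⟩
    exact (hO.stepEval_eq _ (h.left_mem 0 j)).trans (hO.stepEval_eq _ (h.left_mem 0 0)).symm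
  have hgen := hO.generic _ (h.left_mem 0 0)
  have hcard := Set.ncard_le_ncard hsubset (hgen.finite_fibreX hw)
  rwa [hgen.ncard_fibreX hw, Set.ncard_range_of_injective (h.injective_row 0), Nat.card_fin]
    at hcard

lemma IsGrid.vieta (h : IsGrid O U a b) (hO : IsFibred w σ O) (hwidth : mY w + maxY w = 2)
    (i j : Fin 3) :
    ((a i : KK) + b j) * (fibrePoly w (U i j) σ).coeff 2 + (fibrePoly w (U i j) σ).coeff 1 = 0 ∧
      (a i : KK) * b j * (fibrePoly w (U i j) σ).coeff 2 - (fibrePoly w (U i j) σ).coeff 0 =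
        0 := by
  have hroot {v : KKˣ} (hv : (U i j, v) ∈ O) : (fibrePoly w (U i j) σ).IsRoot (v : KK) := by
    rw [Polynomial.IsRoot, eval_fibrePoly, hO.stepEval_eq _ hv, sub_self, mul_zero]
  exact sum_and_product_of_roots ((natDegree_fibrePoly_le w (U i j) σ).trans_eq hwidth)
    (Units.val_injective.ne (h.left_ne_right i j)) (hroot (h.left_mem i j))
    (hroot (h.right_mem i j))

end Grid

section SmallStepGrid

variable {𝒮 : Finset (ℤ × ℤ)} {σ : KK} {O : Set (KKˣ × KKˣ)} {U : Fin 3 → Fin 3 → KKˣ}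
  {a b : Fin 3 → KKˣ}

lemma IsGrid.vieta_unweighted (h : IsGrid O U a b) (hO : IsFibred (unweighted 𝒮) σ O)
    (h𝒮 : 𝒮 ⊆ Finset.Icc (-1) 2 ×ˢ Finset.Icc (-1) 2)
    (hw : ∃ s ∈ (unweighted 𝒮).support, s.2 ≠ 0) (i j : Fin 3) :
    ((a i : KK) + b j) * ∑ k, fibreCubic 𝒮 (mY (unweighted 𝒮)) σ 2 k * (U i j : KK) ^ (k : ℕ) +
        ∑ k, fibreCubic 𝒮 (mY (unweighted 𝒮)) σ 1 k * (U i j : KK) ^ (k : ℕ) = 0 ∧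
      (a i : KK) * b j *
          ∑ k, fibreCubic 𝒮 (mY (unweighted 𝒮)) σ 2 k * (U i j : KK) ^ (k : ℕ) -
        ∑ k, fibreCubic 𝒮 (mY (unweighted 𝒮)) σ 0 k * (U i j : KK) ^ (k : ℕ) = 0 := by
  obtain ⟨hsum, hprod⟩ := h.vieta hO (h.mY_add_maxY hO hw) i j
  simp only [← mul_coeff_fibrePoly_unweighted h𝒮]
  exact ⟨by linear_combination (U i j : KK) * hsum, by linear_combination (U i j : KK) * hprod⟩

lemma IsGrid.gramDet_fibreCubic_eq_zero (h : IsGrid O U a b) (hO : IsFibred (unweighted 𝒮) σ O)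
    (h𝒮 : 𝒮 ⊆ Finset.Icc (-1) 2 ×ˢ Finset.Icc (-1) 2)
    (hw : ∃ s ∈ (unweighted 𝒮).support, s.2 ≠ 0) (x y z : KK) :
    gramDet (rootPairDet (fibreCubic 𝒮 (mY (unweighted 𝒮)) σ 2)
      (fibreCubic 𝒮 (mY (unweighted 𝒮)) σ 1) (fibreCubic 𝒮 (mY (unweighted 𝒮)) σ 0)) x y z = 0 :=
  gramDet_eq_zero_of_grid (u := fun i j => (U i j : KK))
    (Units.val_injective.comp h.left_injective) (Units.val_injective.comp h.right_injective)
    (fun i j => (h.vieta_unweighted hO h𝒮 hw i j).1)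
    (fun i j => (h.vieta_unweighted hO h𝒮 hw i j).2) x y z

end SmallStepGrid

section SmallStepGrid

variable {𝒮 : Finset (ℤ × ℤ)} {σ : KK} {O : Set (KKˣ × KKˣ)} {U : Fin 3 → Fin 3 → KKˣ}
  {a b : Fin 3 → KKˣ}

lemma IsGrid.exists_stepBit_boundary (h : IsGrid O U a b) (hO : IsFibred (unweighted 𝒮) σ O)
    (h𝒮 : 𝒮 ⊆ Finset.Icc (-1) 2 ×ˢ Finset.Icc (-1) 2) (hw : IsNotUnivariate (unweighted 𝒮)) :
    (∃ k, stepBit 𝒮 (2 - mY (unweighted 𝒮)) k) ∧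
      ∀ k : Fin 4, k = 0 ∨ k = 3 → stepBit 𝒮 (2 - mY (unweighted 𝒮)) k ∨
        stepBit 𝒮 (1 - mY (unweighted 𝒮)) k ∨ stepBit 𝒮 (0 - mY (unweighted 𝒮)) k := by
  obtain ⟨hmX, hmaxX, hmY⟩ := width_unweighted_le h𝒮
  have hX := h.three_le_mX_add_maxX hO hw.1
  have hY := h.mY_add_maxY hO hw.2
  have column {s} (hs : s ∈ (unweighted 𝒮).support) {k : Fin 4} (hk : s.1 = (k : ℤ) - 1) :=
    exists_stepBit_column (support_unweighted 𝒮 ▸ hs) hk hY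
  refine ⟨?_, ?_⟩
  · obtain ⟨s, hs, hmax⟩ := exists_snd_eq_maxY (w := unweighted 𝒮) (by omega)
    obtain ⟨k, hk, -⟩ := exists_stepBit h𝒮 (support_unweighted 𝒮 ▸ hs)
    exact ⟨k, by rwa [show (2 : ℤ) - mY (unweighted 𝒮) = s.2 by omega]⟩
  · rintro k (rfl | rfl)
    · obtain ⟨s, hs, hmin⟩ := exists_fst_eq_neg_mX (w := unweighted 𝒮) (by omega)
      exact column hs (by simp only [hmin, Fin.val_zero]; omega)
    · obtain ⟨s, hs, hmax⟩ := exists_fst_eq_maxX (w := unweighted 𝒮) (by omega)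
      exact column hs (by simp only [hmax]; omega)

lemma IsGrid.transcendental (h : IsGrid O U a b) (hO : IsFibred (unweighted 𝒮) σ O)
    (hw : ∃ s ∈ (unweighted 𝒮).support, s.2 ≠ 0) : Transcendental ℤ σ :=
  hO.stepEval_eq _ (h.left_mem 0 0) ▸
    (hO.generic _ (h.left_mem 0 0)).transcendental_int_stepEval hw

lemma IsGrid.mY_eq_one (h : IsGrid O U a b) (hO : IsFibred (unweighted 𝒮) σ O)
    (h𝒮 : 𝒮 ⊆ Finset.Icc (-1) 2 ×ˢ Finset.Icc (-1) 2) (hw : IsNotUnivariate (unweighted 𝒮)) :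
    mY (unweighted 𝒮) = 1 := by
  refine (width_unweighted_le h𝒮).2.2.antisymm (Nat.one_le_iff_ne_zero.2 fun hm => ?_)
  obtain ⟨htop, hcol⟩ := h.exists_stepBit_boundary hO h𝒮 hw
  have hdet := h.gramDet_fibreCubic_eq_zero hO h𝒮 hw.2 0 1 3
  simp only [hm, fibreCubic, Nat.cast_zero, Nat.cast_one, Nat.cast_ofNat, sub_zero, ↓reduceIte,
    OfNat.ofNat_ne_zero, one_ne_zero] at htop hcol hdet
  exact gramDet_shiftedBits_top_ne_zero (h.transcendental hO hw.2) htop (hcol 0 (.inl rfl))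
    (hcol 3 (.inr rfl)) hdet

lemma IsGrid.stepBit_eq (h : IsGrid O U a b) (hO : IsFibred (unweighted 𝒮) σ O)
    (h𝒮 : 𝒮 ⊆ Finset.Icc (-1) 2 ×ˢ Finset.Icc (-1) 2) (hw : IsNotUnivariate (unweighted 𝒮)) :
    (stepBit 𝒮 0 0 ∧ ¬ stepBit 𝒮 0 2 ∧ stepBit 𝒮 0 3) ∧
      (stepBit 𝒮 1 = ![false, false, false, true] ∧
          stepBit 𝒮 (-1) = ![true, false, false, false] ∨
        stepBit 𝒮 1 = ![true, false, false, false] ∧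
          stepBit 𝒮 (-1) = ![false, false, false, true]) := by
  obtain ⟨htop, hcol⟩ := h.exists_stepBit_boundary hO h𝒮 hw
  have hm := h.mY_eq_one hO h𝒮 hw
  have hbottom : ∃ k, stepBit 𝒮 (-1) k := by
    obtain ⟨s, hs, hmin⟩ := exists_snd_eq_neg_mY (w := unweighted 𝒮) (by omega)
    obtain ⟨k, hk, -⟩ := exists_stepBit h𝒮 (support_unweighted 𝒮 ▸ hs)
    exact ⟨k, by rwa [show (-1 : ℤ) = s.2 by omega]⟩
  have hdet := h.gramDet_fibreCubic_eq_zero hO h𝒮 hw.2 0 1 3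
  simp only [hm, fibreCubic, Nat.cast_zero, Nat.cast_one, Nat.cast_ofNat, zero_sub, sub_self,
    OfNat.ofNat_ne_one, zero_ne_one, ↓reduceIte, Int.reduceSub] at htop hcol hdet
  exact eq_of_gramDet_shiftedBits_eq_zero (h.transcendental hO hw.2) htop hbottom
    (hcol 0 (.inl rfl)) (hcol 3 (.inr rfl)) hdet

end SmallStepGrid

section Factorization

variable {K ι κ : Type*} [CommRing K] [IsDomain K] {τ : K} {u : ι → κ → K} {a : ι → K} {b : κ → K}
  {i i' : ι} {j j' : κ}

lemma add_eq_add_of_factorization (hu : ∀ i j, τ * u i j = (1 + a i) * (1 + b j))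
    (ha : a i ≠ a i') (hb : b j ≠ b j')
    (hsum : u i j * (a i - b j) - u i' j * (a i' - b j) + u i' j' * (a i' - b j') -
      u i j' * (a i - b j') = 0) : a i + a i' = b j + b j' := by
  refine sub_eq_zero.1 (mul_left_cancel₀
    (mul_ne_zero (sub_ne_zero.2 ha) (sub_ne_zero.2 hb)) ?_)
  linear_combination τ * hsum - (a i - b j) * hu i j + (a i' - b j) * hu i' j -
    (a i' - b j') * hu i' j' + (a i - b j') * hu i j'

lemma mul_eq_mul_of_factorization (hu : ∀ i j, τ * u i j * (a i * b j) = (1 + a i) * (1 + b j))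
    (ha : a i ≠ a i') (hb : b j ≠ b j')
    (hsum : u i j * (a i - b j) - u i' j * (a i' - b j) + u i' j' * (a i' - b j') -
      u i j' * (a i - b j') = 0) : a i * a i' = b j * b j' := by
  refine sub_eq_zero.1 (mul_left_cancel₀
    (mul_ne_zero (sub_ne_zero.2 ha) (sub_ne_zero.2 hb)) ?_)
  linear_combination -(τ * a i * a i' * b j * b j') * hsum +
    (a i' * b j' * (a i - b j)) * hu i j - (a i * b j' * (a i' - b j)) * hu i' j +
    (a i * b j * (a i' - b j')) * hu i' j' - (a i' * b j * (a i - b j')) * hu i j'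

end Factorization

section SmallStepGrid

variable {𝒮 : Finset (ℤ × ℤ)} {σ : KK} {O : Set (KKˣ × KKˣ)} {U : Fin 3 → Fin 3 → KKˣ}
  {a b : Fin 3 → KKˣ}

lemma IsGrid.alternating_sum_eq_zero (h : IsGrid O U a b) (hdec : DecouplesOn O)
    (i i' j j' : Fin 3) :
    (U i j : KK) * (a i - b j) - U i' j * (a i' - b j) + U i' j' * (a i' - b j') -
      U i j' * (a i - b j') = 0 := by
  obtain ⟨F, G, hFG⟩ := hdec
  have hdiff (i j) : (U i j : KK) * (a i - b j) = G (a i) - G (b j) := by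
    linear_combination hFG _ (h.left_mem i j) - hFG _ (h.right_mem i j)
  linear_combination hdiff i j - hdiff i' j + hdiff i' j' - hdiff i j'

lemma IsGrid.exists_factorization (h : IsGrid O U a b) (hO : IsFibred (unweighted 𝒮) σ O)
    (h𝒮 : 𝒮 ⊆ Finset.Icc (-1) 2 ×ˢ Finset.Icc (-1) 2) (hw : IsNotUnivariate (unweighted 𝒮)) :
    ∃ τ : KK, (∀ i j, τ * U i j = (1 + a i : KK) * (1 + b j)) ∨
      ∀ i j, τ * U i j * (a i * b j) = (1 + a i : KK) * (1 + b j) := by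
  have hvieta := h.vieta_unweighted hO h𝒮 hw.2
  obtain ⟨⟨hB0, hB2, hB3⟩, hAC⟩ := h.stepBit_eq hO h𝒮 hw
  simp only [h.mY_eq_one hO h𝒮 hw, fibreCubic, Nat.cast_zero, Nat.cast_one, Nat.cast_ofNat,
    zero_sub, sub_self, OfNat.ofNat_ne_one, zero_ne_one, ↓reduceIte, Int.reduceSub] at hvieta
  refine ⟨σ - if stepBit 𝒮 0 1 then 1 else 0, ?_⟩
  rcases hAC with ⟨hA, hC⟩ | ⟨hA, hC⟩
  · right
    intro i j
    obtain ⟨hsum, hprod⟩ := hvieta i j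
    simp only [sum_shiftedBits_mul_pow, hA, hC, hB0, hB2, hB3, Matrix.cons_val,
      Bool.false_eq_true, ↓reduceIte] at hsum hprod
    linear_combination (1 + a i + b j : KK) * hprod - (a i * b j : KK) * hsum
  · left
    intro i j
    obtain ⟨hsum, hprod⟩ := hvieta i j
    simp only [sum_shiftedBits_mul_pow, hA, hC, hB0, hB2, hB3, Matrix.cons_val,
      Bool.false_eq_true, ↓reduceIte] at hsum hprod
    linear_combination -hprod - hsum

lemma IsGrid.not_decouplesOn (h : IsGrid O U a b) (hO : IsFibred (unweighted 𝒮) σ O)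
    (h𝒮 : 𝒮 ⊆ Finset.Icc (-1) 2 ×ˢ Finset.Icc (-1) 2) (hw : IsNotUnivariate (unweighted 𝒮)) :
    ¬ DecouplesOn O := by
  intro hdec
  have ha : (a 0 : KK) ≠ a 1 := Units.val_injective.ne (h.left_injective.ne (by decide))
  have hb {j j' : Fin 3} (hj : j ≠ j') : (b j : KK) ≠ b j' :=
    Units.val_injective.ne (h.right_injective.ne hj)
  have hsum (j : Fin 3) := h.alternating_sum_eq_zero hdec 0 1 0 j
  refine hb (j := 1) (j' := 2) (by decide) ?_
  obtain ⟨τ, hτ | hτ⟩ := h.exists_factorization hO h𝒮 hw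
  · have hadd (j : Fin 3) (hj : 0 ≠ j) : (a 0 + a 1 : KK) = b 0 + b j :=
      add_eq_add_of_factorization (u := fun i j => (U i j : KK)) (a := fun i => (a i : KK))
        (b := fun j => (b j : KK)) hτ ha (hb hj) (hsum j)
    exact add_left_cancel ((hadd 1 (by decide)).symm.trans (hadd 2 (by decide)))
  · have hmul (j : Fin 3) (hj : 0 ≠ j) : (a 0 * a 1 : KK) = b 0 * b j :=
      mul_eq_mul_of_factorization (u := fun i j => (U i j : KK)) (a := fun i => (a i : KK))
        (b := fun j => (b j : KK)) hτ ha (hb hj) (hsum j)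
    exact mul_left_cancel₀ (b 0).ne_zero ((hmul 1 (by decide)).symm.trans (hmul 2 (by decide)))

end SmallStepGrid

lemma not_hasGaloisDecoupling_of_O18 {𝒮 : Finset (ℤ × ℤ)}
    (h𝒮 : 𝒮 ⊆ Finset.Icc (-1) 2 ×ˢ Finset.Icc (-1) 2) (hw : IsNotUnivariate (unweighted 𝒮))
    (h : HasOrbitType (unweighted 𝒮) O18) : ¬ HasGaloisDecoupling (unweighted 𝒮) (fX * fY) := by
  intro hdec
  obtain ⟨U, a, b, hgrid | hgrid⟩ := h.exists_isGrid
  · exact hgrid.not_decouplesOn hw.isFibred_orbit h𝒮 hw (hdec.decouplesOn_orbit hw)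
  · have hfibred := hw.isFibred_transpose_preimage_swap_orbit
    have hw' := hw.transpose
    rw [transpose_unweighted] at hfibred hw'
    refine hgrid.not_decouplesOn hfibred (fun s hs => ?_) hw'
      (hdec.decouplesOn_orbit hw).preimage_swap
    rw [Finset.mem_map_equiv] at hs
    exact Finset.mem_product.2 (Finset.mem_product.1 (h𝒮 hs)).symm

/-! ### The models `𝒢_λ` -/

section modelG

variable (lam : ℂ)

lemma support_modelG_subset :
    (modelG lam).support ⊆ {(-1, -1), (0, 1), (1, -1), (2, 1), (1, 0)} := by
  intro s hs
  contrapose! hs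
  simp only [Finset.mem_insert, Finset.mem_singleton, not_or] at hs
  obtain ⟨h₁, h₂, h₃, h₄, h₅⟩ := hs
  simp only [Finsupp.notMem_support_iff, modelG, Finsupp.add_apply, Finsupp.single_apply,
    if_neg (Ne.symm h₁), if_neg (Ne.symm h₂), if_neg (Ne.symm h₃), if_neg (Ne.symm h₄),
    if_neg (Ne.symm h₅), add_zero]

lemma mem_support_modelG : ((-1 : ℤ), (-1 : ℤ)) ∈ (modelG lam).support := by
  simp [modelG]

lemma mX_modelG : mX (modelG lam) = 1 :=
  le_antisymm (Finset.sup_mono (support_modelG_subset lam))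
    (Finset.le_sup (f := fun s : ℤ × ℤ => (-s.1).toNat) (mem_support_modelG lam))

lemma mY_modelG : mY (modelG lam) = 1 :=
  le_antisymm (Finset.sup_mono (support_modelG_subset lam))
    (Finset.le_sup (f := fun s : ℤ × ℤ => (-s.2).toNat) (mem_support_modelG lam))

lemma kernelPoly_modelG : kernelPoly (modelG lam) =
    X 0 * X 1 - X 2 * ((1 + X 0 ^ 2) * (1 + X 0 * X 1 ^ 2) + C lam * X 0 ^ 2 * X 1) := by
  have hsum : (modelG lam).sum (fun s c =>
      (C c * X 0 ^ (s.1 + (1 : ℕ)).toNat * X 1 ^ (s.2 + (1 : ℕ)).toNat : Poly3)) =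
      1 + (X 0 * X 1 ^ 2 + (X 0 ^ 2 + (X 0 ^ 3 * X 1 ^ 2 + C lam * X 0 ^ 2 * X 1))) := by
    rw [Finsupp.sum_of_support_subset _ (support_modelG_subset lam) _ (by simp)]
    simp [modelG, Finsupp.single_apply]
  rw [kernelPoly, mX_modelG, mY_modelG, hsum]
  ring

-- The kernel vanishes at `(1, y, 1 / S(1, y))`, the right-hand side does not.
lemma not_kernelPoly_modelG_dvd :
    ¬ kernelPoly (modelG lam) ∣ X 2 * (1 + X 0 ^ 2) * X 1 := by
  have hroot (y : ℂ) (hy : y ≠ 0) (hS : 2 * (1 + y ^ 2) + lam * y ≠ 0) :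
      ¬ kernelPoly (modelG lam) ∣ X 2 * (1 + X 0 ^ 2) * X 1 := by
    rw [kernelPoly_modelG]
    rintro ⟨Q, hQ⟩
    have h := congrArg (eval ![1, y, y / (2 * (1 + y ^ 2) + lam * y)]) hQ
    simp only [map_mul, map_sub, map_add, map_one, map_pow, eval_X, eval_C,
      Matrix.cons_val_zero, Matrix.cons_val_one, Matrix.cons_val, one_pow, one_mul, mul_one] at h
    rw [one_add_one_eq_two, div_mul_cancel₀ _ hS, sub_self, zero_mul] at h
    exact mul_ne_zero (mul_ne_zero (div_ne_zero hy hS) two_ne_zero) hy h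
  by_cases hone : 2 * (1 + (1 : ℂ) ^ 2) + lam * 1 = 0
  · refine hroot 2 two_ne_zero fun htwo => two_ne_zero (α := ℂ) ?_
    linear_combination htwo - 2 * hone
  · exact hroot 1 one_ne_zero hone

lemma hasGaloisDecoupling_modelG : HasGaloisDecoupling (modelG lam) (fX * fY) := by
  have hinj : Function.Injective (algebraMap Poly3 Frac3) := IsFractionRing.injective _ _
  have hden : (1 + X 0 ^ 2 : Poly3) ≠ 0 := fun h => by simpa using congrArg (eval 0) h
  have hX : fX ∈ fieldXt := IntermediateField.subset_adjoin _ _ (by simp)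
  have ht : ft ∈ fieldXt := IntermediateField.subset_adjoin _ _ (by simp)
  have hY : fY ∈ fieldYt := IntermediateField.subset_adjoin _ _ (by simp)
  have hY0 : fY ≠ 0 := (map_ne_zero_iff _ hinj).2 (X_ne_zero 1)
  have ht0 : ft ≠ 0 := (map_ne_zero_iff _ hinj).2 (X_ne_zero 2)
  have hden0 : 1 + fX ^ 2 ≠ 0 := by
    rw [fX, ← map_pow, ← map_one (algebraMap Poly3 Frac3), ← map_add]
    exact (map_ne_zero_iff _ hinj).2 hden
  refine ⟨fX * (1 / ft - algebraMap ℂ Frac3 lam * fX) / (1 + fX ^ 2), ?_, -1 / fY, ?_,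
    algebraMap Poly3 Frac3 (-1) / algebraMap Poly3 Frac3 (X 2 * (1 + X 0 ^ 2) * X 1),
    ⟨-1, X 2 * (1 + X 0 ^ 2) * X 1, ?_, isUnit_one.neg.isRelPrime_left, rfl,
      not_kernelPoly_modelG_dvd lam⟩, ?_⟩
  · exact div_mem (mul_mem hX (sub_mem (div_mem (one_mem _) ht)
      (mul_mem (fieldXt.algebraMap_mem lam) hX))) (add_mem (one_mem _) (pow_mem hX 2))
  · exact div_mem (neg_mem (one_mem _)) hY
  · exact mul_ne_zero (mul_ne_zero (X_ne_zero 2) hden) (X_ne_zero 1)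
  · have hC : algebraMap Poly3 Frac3 (C lam) = algebraMap ℂ Frac3 lam :=
      (IsScalarTower.algebraMap_apply ℂ Poly3 Frac3 lam).symm
    rw [kernelPoly_modelG]
    simp only [map_mul, map_sub, map_add, map_one, map_pow, map_neg, hC]
    rw [← fX, ← fY, ← ft]
    field_simp
    ring

end modelG

end LargeSteps

end

theorem mainTheorem10 :
    -- Hadamard models, and more generally models whose orbit type is that of a Hadamard model
    (∀ w : LargeSteps.WeightedModel, LargeSteps.IsHadamard w →
      ¬ LargeSteps.HasGaloisDecoupling w (LargeSteps.fX * LargeSteps.fY)) ∧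
    (∀ w : LargeSteps.WeightedModel, LargeSteps.IsNotUnivariate w →
      LargeSteps.HasHadamardOrbitType w →
      ¬ LargeSteps.HasGaloisDecoupling w (LargeSteps.fX * LargeSteps.fY)) ∧
    -- fan models
    (∀ (p : ℕ) (z : ℕ → ℂ), 2 ≤ p → z p ≠ 0 →
      ¬ LargeSteps.HasGaloisDecoupling (LargeSteps.fan p z)
        (LargeSteps.fX * LargeSteps.fY)) ∧
    -- unweighted models with steps in `{-1, 0, 1, 2}²`
    (∀ 𝒮 : Finset (ℤ × ℤ), 𝒮 ⊆ Finset.Icc (-1) 2 ×ˢ Finset.Icc (-1) 2 →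
      LargeSteps.IsNotUnivariate (LargeSteps.unweighted 𝒮) →
      LargeSteps.HasOrbitType (LargeSteps.unweighted 𝒮) LargeSteps.O18 ∨
        LargeSteps.HasOrbitType (LargeSteps.unweighted 𝒮) LargeSteps.O12tilde →
      ¬ LargeSteps.HasGaloisDecoupling (LargeSteps.unweighted 𝒮)
        (LargeSteps.fX * LargeSteps.fY)) ∧
    -- the models `𝒢_lam`
    (∀ lam : ℂ, LargeSteps.HasGaloisDecoupling (LargeSteps.modelG lam)
      (LargeSteps.fX * LargeSteps.fY)) := by
  refine ⟨fun w h => ?_, ?_, fun p z hp hz => ?_, ?_, LargeSteps.hasGaloisDecoupling_modelG⟩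
  · exact LargeSteps.not_hasGaloisDecoupling_of_containsRectangle h.isNotUnivariate
      h.containsRectangle_orbit
  · rintro w hw ⟨w', hHadamard, hΓ⟩
    exact hΓ.not_hasGaloisDecoupling hw
      (LargeSteps.cycleGraph_four_isIndContained_orbitGraph_iff.2 hHadamard.containsRectangle_orbit)
  · exact LargeSteps.not_hasGaloisDecoupling_of_containsRectangle
      LargeSteps.isNotUnivariate_fan (LargeSteps.containsRectangle_orbit_fan hp hz)
  · rintro 𝒮 h𝒮 hw (hΓ | hΓ)
    · exact LargeSteps.not_hasGaloisDecoupling_of_O18 h𝒮 hw hΓ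
    · exact hΓ.not_hasGaloisDecoupling hw LargeSteps.cycleGraph_four_isIndContained_O12tilde
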